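/- Let $H_2$ be the real vector space of $2\times 2$ complex hermitian matrices, $\mathcal P$ the set of rank one (orthogonal) projections in $H_2$, $P^\perp = I-P$, and $\overline{\mathbb R}=\mathbb R\cup\{\infty\}$ the one-point compactification of $\mathbb{R}$. Let $\overline{H_2}$ be the set of all formal sums $aP+bP^\perp$ with $P\in\mathcal P$, $a,b\in\overline{\mathbb R}$, subject to the identifications $aP+bP^\perp=bP^\perp+aP$ and $aP+aP^\perp=aQ+aQ^\perp$; the sums with $a,b\in\mathbb R$ are identified with the matrices in $H_2$. Put $\widehat\infty=\infty P+\infty P^\perp$ (the point at infinity). The coherency relation $\sim$ on $\overline{H_2}$ is the symmetric relation given as follows, where $A,B\in H_2$, $a,b\in\mathbb R$, $P,Q\in\mathcal P$: - $A\sim B$ iff $\operatorname{rank}(A-B)\le 1$; - $\infty P+aP^\perp\sim A$ iff $P^\perp AP^\perp=aP^\perp$; - $\infty P+aP^\perp\sim\infty Q+bQ^\perp$ iff $P=Q$; - $\widehat\infty\sim\widehat\infty$, $\widehat\infty\sim \infty P+aP^\perp$ and $\widehat\infty\not\sim A$. An automorphism of $\overline{H_2}$ is a bijection $\varphi\colon\overline{H_2}\to\overline{H_2}$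 such that $X\sim Y\iff\varphi(X)\sim\varphi(Y)$ for all $X,Y\in\overline{H_2}$. For an invertible $2\times2$ complex matrix $S$ and $B\in H_2$, the maps $X\mapsto -X$, $X\mapsto X^t$, $X\mapsto X+B$, $X\mapsto SXS^*$ on $H_2$ (with $X^t$ the transpose and $S^*$ the conjugate transpose) are extended to $\overline{H_2}$ by letting them fix $\widehat\infty$ and by setting, for $P\in\mathcal P$ and $a\in\mathbb R$, $-(\infty P+aP^\perp)=\infty P+(-a)P^\perp$, $(\infty P+aP^\perp)^t=\infty P^t+a(P^t)^\perp$, $(\infty P+aP^\perp)+B=\infty P+(a+\operatorname{tr}(P^\perp B))P^\perp$, and $S(\infty P+aP^\perp)S^*=\infty Q+a\operatorname{tr}(Q^\perp SS^*)\,Q^\perp$ with $Q=\frac{1}{\operatorname{tr}(SPS^*)}SPS^*$. The inversion of $\overline{H_2}$ is the map $aP+bP^\perp\mapsto a^{-1}P+b^{-1}P^\perp$ ($P\in\mathcal P$, $a,b\in\overline{\mathbb R}$), with the rules $\infty^{-1}=0$ and $0^{-1}=\infty$. An automorphism of $\overline{H_2}$ is called affine if it is of the form $X\mapsto cSXS^*+B$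 or $X\mapsto cSX^tS^*+B$ on $\overline{H_2}$, for some $c\in\{-1,1\}$, some invertible $2\times 2$ complex matrix $S$ and some $B\in H_2$. It is called standard if it is a composition of finitely many maps each of which is an affine automorphism or the inversion. Then every automorphism of $\overline{H_2}$ is standard. Moreover, an automorphism $\varphi$ of $\overline{H_2}$ is affine if and only if $\varphi(\widehat\infty)=\widehat\infty$. -/

import Mathlib

open scoped Matrix

namespace HTwo

/-- `2 × 2` complex matrices. -/
abbrev Mat : Type := Matrix (Fin 2) (Fin 2) ℂ

/-- The real vector space `H₂` of `2 × 2` hermitian matrices. -/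
abbrev H2 : Type := selfAdjoint Mat

/-- The set `𝒫` of all rank one (hermitian) projections. -/
abbrev Proj : Type := {P : Mat // IsStarProjection P ∧ P.rank = 1}

/-- Two `2 × 2` matrices are coherent if their difference has rank at most one. -/
def MatCoherent (A B : Mat) : Prop := (A - B).rank ≤ 1

theorem det_eq_zero_of_rank {M : Mat} (h : M.rank = 1) : M.det = 0 := by
  by_contra hd
  have h2 := Matrix.rank_of_isUnit M
    ((Matrix.isUnit_iff_isUnit_det M).2 (isUnit_iff_ne_zero.2 hd))
  simp [h] at h2

theorem rank_eq_one {M : Mat} (hd : M.det = 0) (h0 : M ≠ 0) : M.rank = 1 := by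
  have h1 : M.rank ≠ 0 := fun h => h0 (by
    rw [Matrix.rank, Submodule.finrank_eq_zero, LinearMap.range_eq_bot] at h
    exact Matrix.ext_of_mulVec_single fun i => by
      rw [Matrix.zero_mulVec]
      exact LinearMap.congr_fun h (Pi.single i 1))
  have h2 : M.rank ≠ 2 := by
    intro h
    have hu : IsUnit M := by
      rw [← Matrix.linearIndependent_rows_iff_isUnit, linearIndependent_iff_card_eq_finrank_span,
        Set.finrank, ← Matrix.rank_eq_finrank_span_row, h]
      simp
    rw [Matrix.isUnit_iff_isUnit_det, hd] at hu
    exact not_isUnit_zero hu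
  have h3 : M.rank ≤ 2 := by simpa using Matrix.rank_le_card_width M
  omega

theorem mul_self_eq {M : Mat} (hd : M.det = 0) : M * M = M.trace • M := by
  rw [Matrix.det_fin_two] at hd
  ext i j
  fin_cases i <;> fin_cases j <;>
    simp [Matrix.mul_apply, Fin.sum_univ_two, Matrix.trace_fin_two] <;>
    first | linear_combination -hd | linear_combination hd | ring

theorem trace_im (A : H2) : (A : Mat).trace.im = 0 := by
  have h : (A : Mat).trace = star (A : Mat).trace := by
    rw [← Matrix.trace_conjTranspose, ← Matrix.star_eq_conjTranspose, A.2.star_eq]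
  have := congrArg Complex.im h
  simp at this
  linarith

theorem trace_eq (A : H2) : (A : Mat).trace = ((A : Mat).trace.re : ℂ) :=
  Complex.ext (by simp) (by simp [trace_im A])

open scoped ComplexOrder in
/-- A nonzero singular hermitian matrix has nonzero trace. -/
theorem trace_ne_zero {A : H2} (hd : (A : Mat).det = 0) (h0 : A ≠ 0) :
    (A : Mat).trace ≠ 0 := by
  intro ht
  apply h0
  have h := mul_self_eq hd
  rw [ht, zero_smul] at h
  have h' : (A : Mat)ᴴ * (A : Mat) = 0 := by
    rw [← Matrix.star_eq_conjTranspose, A.2.star_eq, h]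
  exact Subtype.ext (Matrix.conjTranspose_mul_self_eq_zero.1 h')

namespace Proj

/-- A rank one projection as an element of `H₂`. -/
def toH2 (P : Proj) : H2 := ⟨P.1, P.2.1.isSelfAdjoint⟩

/-- For a hermitian matrix `A` of rank one, the rank one projection `(tr A)⁻¹ A`. -/
noncomputable def ofRankOne (A : H2) (hd : (A : Mat).det = 0) (h0 : A ≠ 0) : Proj :=
  ⟨(A : Mat).trace⁻¹ • (A : Mat), by
    have ht := trace_ne_zero hd h0
    refine ⟨⟨?_, ?_⟩, ?_⟩
    · change _ * _ = _
      rw [smul_mul_smul_comm, mul_self_eq hd, smul_smul]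
      congr 1
      field_simp
    · change star _ = _
      rw [star_smul, A.2.star_eq, trace_eq A]
      congr 1
      rw [← Complex.ofReal_inv]
      exact Complex.conj_ofReal _
    · refine rank_eq_one (by simp [hd]) ?_
      exact smul_ne_zero (inv_ne_zero ht) (fun h => h0 (Subtype.ext h))⟩

theorem det_eq (P : Proj) : P.1.det = 0 := det_eq_zero_of_rank P.2.2

theorem ne_zero (P : Proj) : P.1 ≠ 0 := by
  intro h
  have := P.2.2
  rw [h] at this
  simp at this

theorem trace_eq_one (P : Proj) : P.1.trace = 1 := by
  have h := mul_self_eq P.det_eq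
  have h' : P.1 * P.1 = P.1 := P.2.1.isIdempotentElem
  rw [h'] at h
  have h2 : (P.1.trace - 1) • P.1 = 0 := by rw [sub_smul, ← h, one_smul, sub_self]
  rcases smul_eq_zero.1 h2 with h3 | h3
  · exact sub_eq_zero.1 h3
  · exact absurd h3 P.ne_zero

/-- The complementary projection `P^⊥ = I - P`. -/
def perp (P : Proj) : Proj :=
  ⟨1 - P.1, P.2.1.one_sub, by
    have hd := P.det_eq
    have ht := P.trace_eq_one
    refine rank_eq_one ?_ ?_
    · rw [Matrix.det_fin_two] at hd ⊢
      rw [Matrix.trace_fin_two] at ht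
      simp
      linear_combination hd - ht
    · intro h
      rw [← sub_eq_zero.1 h] at ht
      norm_num [Matrix.trace_fin_two] at ht⟩

/-- The transpose `P^t` of a rank one projection. -/
def transpose (P : Proj) : Proj :=
  ⟨P.1ᵀ, by
    refine ⟨⟨?_, ?_⟩, ?_⟩
    · change P.1ᵀ * P.1ᵀ = P.1ᵀ
      rw [← Matrix.transpose_mul, P.2.1.isIdempotentElem.eq]
    · exact Matrix.IsHermitian.transpose P.2.1.isSelfAdjoint
    · rw [Matrix.rank_transpose, P.2.2]⟩

end Proj

namespace H2

/-- The transpose of a hermitian matrix. -/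
def transpose (A : H2) : H2 :=
  ⟨(A : Mat)ᵀ, Matrix.IsHermitian.transpose A.2⟩

/-- The congruence `A ↦ S A S^*`. -/
def conj (S : GL (Fin 2) ℂ) (A : H2) : H2 :=
  ⟨S.1 * (A : Mat) * S.1ᴴ, A.2.conjugate S.1⟩

/-- The inverse matrix of a hermitian matrix. -/
noncomputable def inv (A : H2) : H2 :=
  ⟨(A : Mat)⁻¹, Matrix.IsHermitian.inv A.2⟩

end H2

/-- For a rank one projection `P`, the rank one projection `Q = (tr (S P S^*))⁻¹ S P S^*`. -/
noncomputable def Proj.conj (S : GL (Fin 2) ℂ) (P : Proj) : Proj :=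
  Proj.ofRankOne (H2.conj S P.toH2)
    (by
      change (S.1 * P.1 * S.1ᴴ).det = 0
      rw [Matrix.det_mul, Matrix.det_mul, P.det_eq]
      ring)
    (by
      intro h
      have h1 : S.1 * P.1 * S.1ᴴ = 0 := congrArg Subtype.val h
      have hS : IsUnit S.1 := S.isUnit
      have hS' : IsUnit S.1ᴴ := hS.star
      exact P.ne_zero (hS.mul_right_eq_zero.1 (hS'.mul_left_eq_zero.1 h1)))

/-- The compactification `H̄₂` of `H₂`: the formal sums `aP + bP^⊥` with `P` a rank one projection
and `a, b ∈ ℝ ∪ {∞}`, modulo `aP + bP^⊥ = bP^⊥ + aP` and `aP + aP^⊥ = aQ + aQ^⊥`.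
By the spectral theorem the sums with `a, b ∈ ℝ` are exactly the elements of `H₂`; the other ones
are `∞P + aP^⊥` with `a ∈ ℝ` (`P` and `a` being uniquely determined) and the point `∞P + ∞P^⊥`.
See `HBar.formalSum`, `HBar.exists_formalSum` and `HBar.formalSum_eq_iff`. -/
inductive HBar : Type
  /-- a hermitian matrix -/
  | fin (A : H2) : HBar
  /-- the point `∞P + aP^⊥` with `a` real -/
  | line (P : Proj) (a : ℝ) : HBar
  /-- the point at infinity `∞P + ∞P^⊥ = ∞Q + ∞Q^⊥` -/
  | inf : HBar

namespace HBar

/-- The point `aP + bP^⊥` of `H̄₂`, where `a, b ∈ ℝ ∪ {∞}`. -/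
noncomputable def formalSum (P : Proj) : OnePoint ℝ → OnePoint ℝ → HBar
  | OnePoint.some a, OnePoint.some b => fin (a • P.toH2 + b • P.perp.toH2)
  | OnePoint.infty, OnePoint.some b => line P b
  | OnePoint.some a, OnePoint.infty => line P.perp a
  | OnePoint.infty, OnePoint.infty => inf

/-- The coherency relation on `H̄₂`. -/
def Coherent : HBar → HBar → Prop
  | fin A, fin B => MatCoherent (B : Mat) (A : Mat)
  | line P a, fin A => P.perp.1 * (A : Mat) * P.perp.1 = (a : ℂ) • P.perp.1
  | fin A, line P a => P.perp.1 * (A : Mat) * P.perp.1 = (a : ℂ) • P.perp.1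
  | line P _, line Q _ => P = Q
  | inf, line _ _ => True
  | line _ _, inf => True
  | inf, inf => True
  | inf, fin _ => False
  | fin _, inf => False

/-- `X ↦ -X`, with the rule `-∞ = ∞`. -/
def neg : HBar → HBar
  | fin A => fin (-A)
  | line P a => line P (-a)
  | inf => inf

/-- The translation `X ↦ X + B` for `B ∈ H₂`. (The trace of `P^⊥ B` is a real number.) -/
noncomputable def add : HBar → H2 → HBar
  | fin A, B => fin (A + B)
  | line P a, B => line P (a + (P.perp.1 * (B : Mat)).trace.re)
  | inf, _ => inf

/-- The transposition `X ↦ X^t`. -/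
def transpose : HBar → HBar
  | fin A => fin A.transpose
  | line P a => line P.transpose a
  | inf => inf

/-- The map `X ↦ S X S^*` for an invertible matrix `S`, with
`S (∞P + aP^⊥) S^* = ∞Q + a tr(Q^⊥ S S^*) Q^⊥` where `Q = (tr (S P S^*))⁻¹ S P S^*`.
(The trace of `Q^⊥ S S^*` is a real number.) -/
noncomputable def conj (S : GL (Fin 2) ℂ) : HBar → HBar
  | fin A => fin (A.conj S)
  | line P a => line (P.conj S) (a * ((P.conj S).perp.1 * (S.1 * S.1ᴴ)).trace.re)
  | inf => inf

/-- Multiplication of a point of `H̄₂` by a sign `c ∈ {-1, 1}`. -/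
def signMul (c : ℤˣ) (X : HBar) : HBar := if c = 1 then X else neg X

open Classical in
/-- The inversion `aP + bP^⊥ ↦ a⁻¹P + b⁻¹P^⊥`, with the rules `∞⁻¹ = 0` and `0⁻¹ = ∞`
(see `inv_formalSum`). A hermitian matrix of rank one is `tP` with `t` its trace, and
`(tP + 0P^⊥)⁻¹ = ∞P^⊥ + t⁻¹P`. -/
noncomputable def inv : HBar → HBar
  | fin A =>
      if hd : (A : Mat).det = 0 then
        if h0 : A = 0 then inf
        else line (Proj.ofRankOne A hd h0).perp ((A : Mat).trace.re)⁻¹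
      else fin A.inv
  | line P a => if a = 0 then line P.perp 0 else fin (a⁻¹ • P.perp.toH2)
  | inf => fin 0

/-- The inverse on `ℝ ∪ {∞}`, with `∞⁻¹ = 0` and `0⁻¹ = ∞`. -/
noncomputable def extInv : OnePoint ℝ → OnePoint ℝ
  | OnePoint.some a => if a = 0 then OnePoint.infty else OnePoint.some a⁻¹
  | OnePoint.infty => OnePoint.some 0

/-- The negative on `ℝ ∪ {∞}`, with `-∞ = ∞`. -/
noncomputable def extNeg : OnePoint ℝ → OnePoint ℝ
  | OnePoint.some a => OnePoint.some (-a)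
  | OnePoint.infty => OnePoint.infty

theorem perp_perp (P : Proj) : P.perp.perp = P := Subtype.ext (sub_sub_cancel _ _)

theorem coe_sum (P : Proj) (a b : ℝ) :
    ((a • P.toH2 + b • P.perp.toH2 : H2) : Mat) = (a : ℂ) • P.1 + (b : ℂ) • (1 - P.1) := by
  ext i j
  simp [Proj.toH2, Proj.perp]

theorem trace_sum (P : Proj) (a b : ℝ) :
    ((a • P.toH2 + b • P.perp.toH2 : H2) : Mat).trace = a + b := by
  rw [coe_sum, Matrix.trace_add, Matrix.trace_smul, Matrix.trace_smul, Matrix.trace_sub,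
    P.trace_eq_one]
  simp
  norm_num

theorem det_sum (P : Proj) (a b : ℝ) :
    ((a • P.toH2 + b • P.perp.toH2 : H2) : Mat).det = a * b := by
  rw [coe_sum]
  have hd := P.det_eq
  have ht := P.trace_eq_one
  rw [Matrix.det_fin_two] at hd ⊢
  rw [Matrix.trace_fin_two] at ht
  simp
  linear_combination (a - b : ℂ) ^ 2 * hd + b * (a - b) * ht

theorem ofRankOne_smul (P : Proj) {t : ℝ} (ht : t ≠ 0) (A : H2) (hA : A = t • P.toH2) (hd h0) :
    Proj.ofRankOne A hd h0 = P := by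
  have hA' : (A : Mat) = (t : ℂ) • P.1 := by
    rw [hA]; ext i j; simp [Proj.toH2]
  refine Subtype.ext ?_
  change (A : Mat).trace⁻¹ • (A : Mat) = P.1
  have ht' : (t : ℂ) ≠ 0 := by exact_mod_cast ht
  rw [hA', Matrix.trace_smul, P.trace_eq_one, smul_smul, smul_eq_mul, mul_one,
    inv_mul_cancel₀ ht', one_smul]

/-- Every point of `H̄₂` is a formal sum `aP + bP^⊥`. -/
theorem exists_formalSum (X : HBar) : ∃ P a b, X = formalSum P a b := by
  have P₀ : Proj := ⟨Matrix.diagonal ![1, 0], by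
    refine ⟨⟨?_, ?_⟩, rank_eq_one (by simp) ?_⟩
    · ext i j
      fin_cases i <;> fin_cases j <;> simp [Matrix.mul_apply]
    · ext i j
      fin_cases i <;> fin_cases j <;> simp
    · intro h
      simpa using congrFun (congrFun h 0) 0⟩
  cases X with
  | inf => exact ⟨P₀, OnePoint.infty, OnePoint.infty, rfl⟩
  | line P a => exact ⟨P, OnePoint.infty, OnePoint.some a, rfl⟩
  | fin A =>
    have h00 : (A : Mat) 0 0 = (((A : Mat) 0 0).re : ℂ) :=
      (Complex.conj_eq_iff_re.1 (congrFun (congrFun A.2.star_eq 0) 0)).symm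
    have h11 : (A : Mat) 1 1 = (((A : Mat) 1 1).re : ℂ) :=
      (Complex.conj_eq_iff_re.1 (congrFun (congrFun A.2.star_eq 1) 1)).symm
    have h10 : (A : Mat) 1 0 = star ((A : Mat) 0 1) :=
      (congrFun (congrFun A.2.star_eq 1) 0).symm
    set p := ((A : Mat) 0 0).re
    set q := ((A : Mat) 1 1).re
    set z := (A : Mat) 0 1
    have hz : z * star z = ((Complex.normSq z : ℝ) : ℂ) := Complex.mul_conj z
    have hn := Complex.normSq_nonneg z
    set r := Real.sqrt ((p - q) ^ 2 + 4 * Complex.normSq z)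
    have hr : r ^ 2 = (p - q) ^ 2 + 4 * Complex.normSq z := Real.sq_sqrt (by positivity)
    have hrC : (r : ℂ) ^ 2 = ((p : ℂ) - q) ^ 2 + 4 * (z * star z) := by
      rw [hz]; exact_mod_cast hr
    set m : ℝ := (p + q - r) / 2 with hm
    have hmC : (m : ℂ) = ((p : ℂ) + q - r) / 2 := by rw [hm]; push_cast; ring
    have hone : ((1 : H2) : Mat) = 1 := rfl
    have hB : ((A - m • (1 : H2) : H2) : Mat) = (A : Mat) - (m : ℂ) • (1 : Mat) := by
      ext i j
      simp
    have hd : ((A - m • (1 : H2) : H2) : Mat).det = 0 := by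
      rw [hB, Matrix.det_fin_two]
      simp only [Matrix.sub_apply, Matrix.smul_apply, smul_eq_mul, Matrix.one_apply_eq, ne_eq,
        zero_ne_one, one_ne_zero, not_false_eq_true, Matrix.one_apply_ne]
      rw [h00, h11, h10, hmC]
      linear_combination hrC / 4
    by_cases h0 : A - m • (1 : H2) = 0
    · refine ⟨P₀, OnePoint.some m, OnePoint.some m, ?_⟩
      have hA : A = m • (1 : H2) := sub_eq_zero.1 h0
      simp only [formalSum]
      congr 1
      refine Subtype.ext ?_
      rw [coe_sum, ← smul_add, hA]
      ext i j
      simp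
    · refine ⟨Proj.ofRankOne _ hd h0, OnePoint.some (m + r), OnePoint.some m, ?_⟩
      simp only [formalSum]
      congr 1
      refine Subtype.ext ?_
      rw [coe_sum]
      have ht := trace_ne_zero hd h0
      have htr : ((A - m • (1 : H2) : H2) : Mat).trace = r := by
        rw [hB, Matrix.trace_fin_two]
        simp only [Matrix.sub_apply, Matrix.smul_apply, smul_eq_mul, Matrix.one_apply_eq]
        rw [h00, h11, hmC]
        ring
      rw [htr] at ht
      have hP : (r : ℂ) • (Proj.ofRankOne _ hd h0).1 = (A : Mat) - (m : ℂ) • (1 : Mat) := by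
        change (r : ℂ) • (Matrix.trace _)⁻¹ • _ = _
        rw [htr, smul_smul, mul_inv_cancel₀ ht, one_smul, hB]
      rw [Complex.ofReal_add, add_smul, hP, smul_sub]
      abel

theorem sum_injective (P Q : Proj) {a b : ℝ} (hab : a ≠ b)
    (h : (a • P.toH2 + b • P.perp.toH2 : H2) = a • Q.toH2 + b • Q.perp.toH2) : P = Q := by
  have h1 := congrArg Subtype.val h
  rw [coe_sum, coe_sum] at h1
  have h2 : ((a : ℂ) - b) • (P.1 - Q.1) = 0 := by
    calc ((a : ℂ) - b) • (P.1 - Q.1)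
        = ((a : ℂ) • P.1 + (b : ℂ) • (1 - P.1)) - ((a : ℂ) • Q.1 + (b : ℂ) • (1 - Q.1)) := by
          module
      _ = 0 := by rw [h1, sub_self]
  rcases smul_eq_zero.1 h2 with h3 | h3
  · exact absurd (by exact_mod_cast sub_eq_zero.1 h3) hab
  · exact Subtype.ext (sub_eq_zero.1 h3)

/-- Two formal sums agree exactly when the two rules identify them. -/
theorem formalSum_eq_iff (P Q : Proj) (a b c d : OnePoint ℝ) :
    formalSum P a b = formalSum Q c d ↔
      (P = Q ∧ a = c ∧ b = d) ∨ (P = Q.perp ∧ a = d ∧ b = c) ∨ (a = b ∧ b = c ∧ c = d) := by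
  have hpp : P = Q.perp ↔ P.perp = Q :=
    ⟨fun h => by rw [h, perp_perp], fun h => by rw [← h, perp_perp]⟩
  induction a using OnePoint.rec <;> induction b using OnePoint.rec <;>
    induction c using OnePoint.rec <;> induction d using OnePoint.rec <;>
    simp only [formalSum, fin.injEq, line.injEq, reduceCtorEq, OnePoint.coe_ne_infty,
      OnePoint.infty_ne_coe, OnePoint.coe_eq_coe, and_false, false_and, and_true, true_and,
      or_false, false_or, or_true, hpp, and_self]
  · exact and_congr_left fun _ => ⟨fun h => by rw [← perp_perp P, h, perp_perp], fun h => by rw [h]⟩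
  · rename_i a b c d
    constructor
    · intro h
      have ht := trace_sum P a b
      have hd := det_sum P a b
      rw [h, trace_sum] at ht
      rw [h, det_sum] at hd
      have ht' : c + d = a + b := by exact_mod_cast ht
      have hd' : c * d = a * b := by exact_mod_cast hd
      have hac : (a - c) * (a - d) = 0 := by linear_combination hd' - a * ht'
      by_cases hab : a = b
      · right; right
        have hcd : (c - d) ^ 2 = 0 := by
          linear_combination (c + d + a + b) * ht' - 4 * hd' + (a - b) * hab
        have hcd' : c = d := sub_eq_zero.1 (pow_eq_zero_iff two_ne_zero |>.1 hcd)
        exact ⟨hab, by linarith, hcd'⟩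
      · rcases mul_eq_zero.1 hac with h1 | h1
        · have e1 : a = c := by linarith
          have e2 : b = d := by linarith
          subst e1 e2
          exact Or.inl ⟨sum_injective P Q hab h, rfl, rfl⟩
        · have e1 : a = d := by linarith
          have e2 : b = c := by linarith
          subst e1 e2
          refine Or.inr (Or.inl ⟨?_, rfl, rfl⟩)
          rw [← hpp]
          refine sum_injective P Q.perp hab ?_
          rw [h, perp_perp, add_comm]
    · have hs : ∀ R : Proj, R.toH2 + R.perp.toH2 = 1 := fun R =>
        Subtype.ext (add_sub_cancel R.1 1)
      rintro (⟨rfl, rfl, rfl⟩ | ⟨rfl, rfl, rfl⟩ | ⟨rfl, rfl, rfl⟩)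
      · rfl
      · rw [perp_perp, add_comm]
      · rw [← smul_add, ← smul_add, hs, hs]

theorem neg_formalSum (P : Proj) (a b : OnePoint ℝ) :
    neg (formalSum P a b) = formalSum P (extNeg a) (extNeg b) := by
  induction a using OnePoint.rec <;> induction b using OnePoint.rec <;>
    simp [formalSum, neg, extNeg, add_comm]

theorem transpose_formalSum (P : Proj) (a b : OnePoint ℝ) :
    transpose (formalSum P a b) = formalSum P.transpose a b := by
  have hp : P.perp.transpose = P.transpose.perp := by
    refine Subtype.ext ?_
    simp [Proj.perp, Proj.transpose]
  induction a using OnePoint.rec <;> induction b using OnePoint.rec <;>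
    simp [formalSum, transpose, hp]
  refine Subtype.ext ?_
  rw [coe_sum]
  simp only [H2.transpose]
  rw [coe_sum]
  simp [Proj.transpose]

theorem inv_formalSum (P : Proj) (a b : OnePoint ℝ) :
    inv (formalSum P a b) = formalSum P (extInv a) (extInv b) := by
  have hz : ∀ R : Proj, (0 : ℝ) • R.toH2 = 0 := fun R => zero_smul _ _
  induction a using OnePoint.rec with
  | infty =>
    induction b using OnePoint.rec with
    | infty => simp [formalSum, inv, extInv]
    | coe b => by_cases hb : b = 0 <;> simp [formalSum, inv, extInv, hb]
  | coe a =>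
    induction b using OnePoint.rec with
    | infty => by_cases ha : a = 0 <;> simp [formalSum, inv, extInv, ha, perp_perp]
    | coe b =>
      have hd := det_sum P a b
      have ht := trace_sum P a b
      have hs := coe_sum P a b
      by_cases ha : a = 0 <;> by_cases hb : b = 0
      · simp [formalSum, inv, extInv, ha, hb]
      · subst ha
        have h0 : ((0 : ℝ) • P.toH2 + b • P.perp.toH2 : H2) ≠ 0 := by
          intro h
          rw [h] at ht
          simp at ht
          exact hb (by exact_mod_cast ht.symm)
        have hd' : ((0 : ℝ) • P.toH2 + b • P.perp.toH2 : H2).1.det = 0 := by rw [hd]; simp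
        simp only [formalSum, inv, extInv, dif_pos hd', dif_neg h0, if_neg hb, if_true]
        rw [ofRankOne_smul P.perp hb _ (by rw [hz, zero_add]), perp_perp, ht]
        simp
      · subst hb
        have h0 : (a • P.toH2 + (0 : ℝ) • P.perp.toH2 : H2) ≠ 0 := by
          intro h
          rw [h] at ht
          simp at ht
          exact ha (by exact_mod_cast ht.symm)
        have hd' : (a • P.toH2 + (0 : ℝ) • P.perp.toH2 : H2).1.det = 0 := by rw [hd]; simp
        simp only [formalSum, inv, extInv, dif_pos hd', dif_neg h0, if_neg ha, if_true]
        rw [ofRankOne_smul P ha _ (by rw [hz, add_zero]), ht]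
        simp
      · have ha' : (a : ℂ) ≠ 0 := by exact_mod_cast ha
        have hb' : (b : ℂ) ≠ 0 := by exact_mod_cast hb
        have hd' : (a • P.toH2 + b • P.perp.toH2 : H2).1.det ≠ 0 := by
          rw [hd]; exact mul_ne_zero ha' hb'
        simp only [formalSum, inv, extInv, dif_neg hd', if_neg ha, if_neg hb]
        congr 1
        refine Subtype.ext ?_
        rw [coe_sum]
        change (a • P.toH2 + b • P.perp.toH2 : H2).1⁻¹ = _
        rw [hs]
        have hP : P.1 * P.1 = P.1 := P.2.1.isIdempotentElem
        refine Matrix.inv_eq_right_inv ?_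
        simp only [add_mul, mul_add, smul_mul_smul_comm, mul_sub, sub_mul, mul_one, one_mul, hP,
          sub_self, smul_zero, add_zero, zero_add, sub_zero]
        push_cast
        rw [mul_inv_cancel₀ ha', mul_inv_cancel₀ hb', one_smul, one_smul]
        abel

/-- Automorphisms of `H̄₂`: bijections that preserve coherency in both directions. -/
def IsAutomorphism (φ : HBar → HBar) : Prop :=
  Function.Bijective φ ∧ ∀ A B : HBar, Coherent A B ↔ Coherent (φ A) (φ B)

/-- Affine automorphisms of `H̄₂`. -/
def IsAffineAutomorphism (φ : HBar → HBar) : Prop :=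
  IsAutomorphism φ ∧ ∃ (c : ℤˣ) (S : GL (Fin 2) ℂ) (B : H2),
    (∀ X, φ X = add (signMul c (conj S X)) B) ∨
    (∀ X, φ X = add (signMul c (conj S (transpose X))) B)

/-- Compositions of finitely many affine automorphisms and inversions. -/
inductive IsStandardComposition : (HBar → HBar) → Prop
  | affine {φ : HBar → HBar} (h : IsAffineAutomorphism φ) : IsStandardComposition φ
  | inversion : IsStandardComposition inv
  | comp {φ ψ : HBar → HBar} (hφ : IsStandardComposition φ) (hψ : IsStandardComposition ψ) :
      IsStandardComposition (φ ∘ ψ)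

/-- Standard automorphisms of `H̄₂`. -/
def IsStandardAutomorphism (φ : HBar → HBar) : Prop :=
  IsAutomorphism φ ∧ IsStandardComposition φ

end HBar

end HTwo

/-! On the four-dimensional space `H2` twice the determinant is a Lorentzian quadratic form with
bilinear form `pol`. Hermitian matrices are coherent when their difference is null, and `line P a`
is coherent to exactly the matrices on the null hyperplane `pol P.toH2 A = a`.

An automorphism fixing `inf` permutes the lines, which are the other points coherent to `inf`, and
hence maps `H2` onto itself. Lines are mutually coherent exactly when their hyperplanes are
parallel, so `pol (π P) (φ A) = f P (pol P A)` for a map `π` of projections and bijections `f P` of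
the reals; a translation gives `φ 0 = 0` (`NullMap`). A linear relation with nonzero coefficients
between five projections, four of them a basis, becomes a Cauchy equation for the `f P` and makes
`φ` additive. A matrix is definite when no projection annihilates it under `pol`, so `φ` preserves
definiteness. Up to a global sign the `f P` are then positive on positive numbers, and additive with
that property means linear (`NullMap.linear_of_pos`).

A linear map that preserves singularity and sends positive semidefinite rank one matrices to such is
a congruence, possibly after a transposition: a congruence makes it fix the two diagonal
projections, and what remains is a rotation or reflection of the off-diagonal entry
(`exists_conj_of_fixed`). Values on lines are forced by those on `H2` (`eq_of_eq_on_fin`).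

For a general automorphism, translations and at most two inversions bring the image of `inf` back to
`inf`. The inversion is an automorphism because it comes from an isometry of a quadric model
(`coherent_iff`, `quadric_inv`). -/

namespace HTwo

/-! ### Real coordinates on `H2` and the polarized determinant. -/

namespace H2

/-- The hermitian matrix with diagonal entries `p`, `q` and upper right entry `x + iy`. -/
def mk (p q x y : ℝ) : H2 :=
  ⟨!![(p : ℂ), ⟨x, y⟩; ⟨x, -y⟩, (q : ℂ)], by
    change star _ = _
    ext i j
    fin_cases i <;> fin_cases j <;> simp [Matrix.star_apply, Complex.ext_iff]⟩

theorem exists_mk (A : H2) : ∃ p q x y, A = mk p q x y := by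
  have h := A.2.star_eq
  have h00 := congrFun (congrFun h 0) 0
  have h11 := congrFun (congrFun h 1) 1
  have h01 := congrFun (congrFun h 0) 1
  simp only [Matrix.star_apply, Complex.ext_iff, RCLike.star_def, Complex.conj_re,
    Complex.conj_im] at h00 h11 h01
  refine ⟨((A : Mat) 0 0).re, ((A : Mat) 1 1).re, ((A : Mat) 0 1).re, ((A : Mat) 0 1).im,
    Subtype.ext ?_⟩
  ext i j
  fin_cases i <;> fin_cases j <;> simp [mk, Complex.ext_iff] <;> grind

theorem mk_inj {p q x y p' q' x' y' : ℝ} :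
    mk p q x y = mk p' q' x' y' ↔ p = p' ∧ q = q' ∧ x = x' ∧ y = y' := by
  constructor
  · intro h
    have h1 := congrArg Subtype.val h
    have h00 := congrFun (congrFun h1 0) 0
    have h11 := congrFun (congrFun h1 1) 1
    have h01 := congrFun (congrFun h1 0) 1
    simp [mk] at h00 h11 h01
    exact ⟨h00, h11, h01⟩
  · rintro ⟨rfl, rfl, rfl, rfl⟩
    rfl

theorem mk_add (p q x y p' q' x' y' : ℝ) :
    mk p q x y + mk p' q' x' y' = mk (p + p') (q + q') (x + x') (y + y') := by
  refine Subtype.ext ?_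
  ext i j
  fin_cases i <;> fin_cases j <;> simp [mk, Complex.ext_iff]
  ring

theorem smul_mk (t p q x y : ℝ) : t • mk p q x y = mk (t * p) (t * q) (t * x) (t * y) := by
  refine Subtype.ext ?_
  ext i j
  fin_cases i <;> fin_cases j <;> simp [mk, Complex.ext_iff]

theorem transpose_mk (p q x y : ℝ) : (mk p q x y).transpose = mk p q x (-y) := by
  refine Subtype.ext ?_
  ext i j
  fin_cases i <;> fin_cases j <;> simp [mk, transpose]

/-- The polarization of the determinant: `pol A B` is the trace of `A` times the adjugate of `B`. -/
def pol (A B : H2) : ℝ :=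
  ((A : Mat) 0 0 * (B : Mat) 1 1 + (A : Mat) 1 1 * (B : Mat) 0 0
    - (A : Mat) 0 1 * (B : Mat) 1 0 - (A : Mat) 1 0 * (B : Mat) 0 1).re

theorem pol_mk (p q x y p' q' x' y' : ℝ) :
    pol (mk p q x y) (mk p' q' x' y') = p * q' + q * p' - 2 * (x * x' + y * y') := by
  simp [pol, mk]; ring

theorem pol_comm (A B : H2) : pol A B = pol B A := by
  simp only [pol]; congr 1; ring

theorem pol_add (A B C : H2) : pol A (B + C) = pol A B + pol A C := by
  simp [pol]; ring

theorem add_pol (A B C : H2) : pol (A + B) C = pol A C + pol B C := by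
  rw [pol_comm, pol_add, pol_comm C, pol_comm C]

theorem pol_smul (t : ℝ) (A B : H2) : pol A (t • B) = t * pol A B := by
  simp [pol]; ring

theorem smul_pol (t : ℝ) (A B : H2) : pol (t • A) B = t * pol A B := by
  rw [pol_comm, pol_smul, pol_comm]

theorem pol_neg (A B : H2) : pol A (-B) = -pol A B := by
  simp [pol]; ring

theorem pol_sub (A B C : H2) : pol A (B - C) = pol A B - pol A C := by
  rw [sub_eq_add_neg, pol_add, pol_neg, sub_eq_add_neg]

theorem pol_zero (A : H2) : pol A 0 = 0 := by simp [pol]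

theorem det_eq (A : H2) : (A : Mat).det = ((pol A A / 2 : ℝ) : ℂ) := by
  obtain ⟨p, q, x, y, rfl⟩ := exists_mk A
  rw [pol_mk, Matrix.det_fin_two]
  simp [mk, Complex.ext_iff]
  constructor <;> ring

theorem det_eq_zero_iff (A : H2) : (A : Mat).det = 0 ↔ pol A A = 0 := by
  rw [det_eq]
  norm_cast
  constructor <;> intro h <;> linarith

theorem conj_add (S : GL (Fin 2) ℂ) (A B : H2) : conj S (A + B) = conj S A + conj S B :=
  Subtype.ext (by simp [conj, mul_add, add_mul])

theorem conj_smul (S : GL (Fin 2) ℂ) (t : ℝ) (A : H2) : conj S (t • A) = t • conj S A :=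
  Subtype.ext (by simp [conj])

theorem conj_mul (S T : GL (Fin 2) ℂ) (A : H2) : conj (S * T) A = conj S (conj T A) :=
  Subtype.ext (by simp [conj, mul_assoc])

theorem conj_one (A : H2) : conj 1 A = A := Subtype.ext (by simp [conj])

theorem conj_inv_conj (S : GL (Fin 2) ℂ) (A : H2) : conj S⁻¹ (conj S A) = A := by
  rw [← conj_mul, inv_mul_cancel, conj_one]

theorem conj_conj_inv (S : GL (Fin 2) ℂ) (A : H2) : conj S (conj S⁻¹ A) = A := by
  rw [← conj_mul, mul_inv_cancel, conj_one]

theorem pol_conj_self (S : GL (Fin 2) ℂ) {A : H2} (h : pol A A = 0) :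
    pol (conj S A) (conj S A) = 0 := by
  rw [← det_eq_zero_iff] at h ⊢
  simp [conj, h]

/-- On the diagonal `A = B` this is multiplicativity of the determinant; polarization gives the
rest. -/
theorem pol_conj (S : GL (Fin 2) ℂ) (A B : H2) :
    pol (conj S A) (conj S B) = Complex.normSq S.1.det * pol A B := by
  have key : ∀ C : H2, pol (conj S C) (conj S C) = Complex.normSq S.1.det * pol C C := by
    intro C
    have h : ((conj S C : H2) : Mat).det = S.1.det * (C : Mat).det * star S.1.det := by
      simp [conj, Matrix.det_conjTranspose]
    rw [det_eq, det_eq, mul_right_comm] at h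
    have h2 : S.1.det * star S.1.det = ((Complex.normSq S.1.det : ℝ) : ℂ) := Complex.mul_conj _
    rw [h2] at h
    have h3 : pol (conj S C) (conj S C) / 2 = Complex.normSq S.1.det * (pol C C / 2) := by
      exact_mod_cast h
    linarith
  have h := key (A + B)
  have hA := key A
  have hB := key B
  simp only [conj_add, pol_add, add_pol] at h
  rw [pol_comm B A, pol_comm (conj S B) (conj S A)] at h
  linarith

theorem pol_transpose (A B : H2) : pol A.transpose B.transpose = pol A B := by
  obtain ⟨p, q, x, y, rfl⟩ := exists_mk A
  obtain ⟨p', q', x', y', rfl⟩ := exists_mk B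
  rw [transpose_mk, transpose_mk, pol_mk, pol_mk]; ring

end H2

open H2

/-! ### Rank one projections as normalized null vectors. -/

namespace Proj

theorem exists_mk (P : Proj) :
    ∃ p q x y : ℝ, P.toH2 = mk p q x y ∧ p + q = 1 ∧ p * q = x ^ 2 + y ^ 2 := by
  obtain ⟨p, q, x, y, h⟩ := H2.exists_mk P.toH2
  have ht := P.trace_eq_one
  have hd := (det_eq_zero_iff P.toH2).1 P.det_eq
  have h' : P.1 = (mk p q x y).1 := congrArg Subtype.val h
  rw [h, pol_mk] at hd
  rw [h', Matrix.trace_fin_two] at ht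
  refine ⟨p, q, x, y, h, ?_, by linarith⟩
  have := congrArg Complex.re ht
  simpa [mk] using this

theorem toH2_injective : Function.Injective toH2 := fun _ _ h =>
  Subtype.ext (congrArg (fun A : H2 => (A : Mat)) h)

/-- A singular hermitian matrix of trace one is a rank one projection. -/
theorem exists_toH2_eq_mk {p q x y : ℝ} (h1 : p + q = 1) (h2 : p * q = x ^ 2 + y ^ 2) :
    ∃ P : Proj, P.toH2 = mk p q x y := by
  have hd : (mk p q x y : Mat).det = 0 := by
    rw [det_eq_zero_iff, pol_mk]; linarith
  have ht : (mk p q x y : Mat).trace = 1 := by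
    rw [Matrix.trace_fin_two]
    simp only [mk, Matrix.of_apply, Matrix.cons_val]
    exact_mod_cast h1
  have h0 : mk p q x y ≠ 0 := by
    intro h
    rw [h] at ht
    simp at ht
  refine ⟨ofRankOne _ hd h0, Subtype.ext ?_⟩
  change (mk p q x y : Mat).trace⁻¹ • (mk p q x y : Mat) = _
  rw [ht, inv_one, one_smul]

theorem exists_smul_toH2_eq_mk {p q x y : ℝ} (h1 : p + q ≠ 0) (h2 : p * q = x ^ 2 + y ^ 2) :
    ∃ P : Proj, (p + q) • P.toH2 = mk p q x y := by
  obtain ⟨P, hP⟩ := exists_toH2_eq_mk (p := p / (p + q)) (q := q / (p + q)) (x := x / (p + q))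
    (y := y / (p + q)) (by field_simp) (by field_simp; exact h2)
  refine ⟨P, ?_⟩
  rw [hP, smul_mk, mk_inj]
  refine ⟨?_, ?_, ?_, ?_⟩ <;> field_simp

theorem toH2_ofRankOne {A : H2} (hd : (A : Mat).det = 0) (h0 : A ≠ 0) :
    ∃ t : ℝ, t ≠ 0 ∧ (A : Mat).trace = t ∧ t • (ofRankOne A hd h0).toH2 = A := by
  have ht := trace_ne_zero hd h0
  have h1 := trace_eq A
  refine ⟨(A : Mat).trace.re, fun h => ht (by rw [h1, h]; simp), h1, Subtype.ext ?_⟩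
  change (A : Mat).trace.re • ((A : Mat).trace⁻¹ • (A : Mat)) = (A : Mat)
  rw [← Complex.coe_smul, ← h1, smul_smul, mul_inv_cancel₀ ht, one_smul]

theorem perp_toH2 {P : Proj} {p q x y : ℝ} (h : P.toH2 = mk p q x y) (h1 : p + q = 1) :
    P.perp.toH2 = mk q p (-x) (-y) := by
  have h' : P.1 = (mk p q x y).1 := congrArg Subtype.val h
  have h1' : (p : ℂ) + q = 1 := by exact_mod_cast h1
  refine Subtype.ext ?_
  change 1 - P.1 = _
  rw [h']
  ext i j
  fin_cases i <;> fin_cases j <;> simp [mk, Complex.ext_iff] <;> linarith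

theorem pol_self (P : Proj) : pol P.toH2 P.toH2 = 0 := (det_eq_zero_iff P.toH2).1 P.det_eq

/-- Since `P - Q` has trace zero, the pairing is minus its determinant, a sum of three squares of
coordinate differences. Vanishing of the same sum gives `pol_eq_zero_iff`. -/
theorem pol_nonneg (P Q : Proj) : 0 ≤ pol P.toH2 Q.toH2 := by
  obtain ⟨p, q, x, y, h, h1, h2⟩ := P.exists_mk
  obtain ⟨p', q', x', y', h', h1', h2'⟩ := Q.exists_mk
  rw [h, h', pol_mk]
  have : p * q' + q * p' - 2 * (x * x' + y * y') = (p - p') ^ 2 + (x - x') ^ 2 + (y - y') ^ 2 := by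
    grind
  rw [this]
  positivity

theorem pol_eq_zero_iff (P Q : Proj) : pol P.toH2 Q.toH2 = 0 ↔ P = Q := by
  refine ⟨fun hpq => ?_, fun h => by rw [h, pol_self]⟩
  obtain ⟨p, q, x, y, h, h1, h2⟩ := P.exists_mk
  obtain ⟨p', q', x', y', h', h1', h2'⟩ := Q.exists_mk
  rw [h, h', pol_mk] at hpq
  have hs : (p - p') ^ 2 + (x - x') ^ 2 + (y - y') ^ 2 = 0 := by grind
  have e1 : p - p' = 0 := by nlinarith [sq_nonneg (p - p'), sq_nonneg (x - x'), sq_nonneg (y - y')]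
  have e2 : x - x' = 0 := by nlinarith [sq_nonneg (p - p'), sq_nonneg (x - x'), sq_nonneg (y - y')]
  have e3 : y - y' = 0 := by nlinarith [sq_nonneg (p - p'), sq_nonneg (x - x'), sq_nonneg (y - y')]
  refine toH2_injective ?_
  rw [h, h', mk_inj]
  refine ⟨?_, ?_, ?_, ?_⟩ <;> linarith

theorem trace_perp_mul (P : Proj) (A : H2) :
    (P.perp.1 * (A : Mat)).trace = ((pol P.toH2 A : ℝ) : ℂ) := by
  obtain ⟨p, q, x, y, h, h1, -⟩ := P.exists_mk
  obtain ⟨p', q', x', y', rfl⟩ := H2.exists_mk A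
  have h' : P.perp.1 = (mk q p (-x) (-y)).1 := congrArg Subtype.val (perp_toH2 h h1)
  rw [h', h, pol_mk, Matrix.trace_fin_two]
  simp [mk, Matrix.mul_apply, Fin.sum_univ_two, Complex.ext_iff]
  constructor <;> ring

/-- A singular `M` is `u v^*`, and `v^* A u` is a scalar. This turns the matrix equation that
defines coherency with a line into one real equation. -/
theorem mul_mul_self {M : Mat} (hd : M.det = 0) (A : Mat) : M * A * M = (M * A).trace • M := by
  rw [Matrix.det_fin_two] at hd
  ext i j
  fin_cases i <;> fin_cases j <;>
    simp [Matrix.mul_apply, Fin.sum_univ_two, Matrix.trace_fin_two] <;> grind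

theorem perp_mul_mul_perp_iff (P : Proj) (A : H2) (a : ℝ) :
    P.perp.1 * (A : Mat) * P.perp.1 = (a : ℂ) • P.perp.1 ↔ pol P.toH2 A = a := by
  rw [mul_mul_self P.perp.det_eq, trace_perp_mul]
  constructor
  · intro h
    have := smul_left_injective ℂ P.perp.ne_zero h
    exact_mod_cast this
  · rintro rfl
    rfl

end Proj

/-! ### Coherency through `pol`, the quadric model and the inversion. -/

namespace HBar

theorem coherent_fin_fin (A B : H2) :
    Coherent (fin A) (fin B) ↔ pol (A - B) (A - B) = 0 := by
  have h : ∀ C : H2, (C : Mat).rank ≤ 1 ↔ pol C C = 0 := by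
    intro C
    rw [← det_eq_zero_iff]
    constructor
    · intro hr
      by_contra hd
      have h2 := Matrix.rank_of_isUnit (C : Mat)
        ((Matrix.isUnit_iff_isUnit_det _).2 (isUnit_iff_ne_zero.2 hd))
      simp [h2] at hr
    · intro hd
      by_cases h0 : (C : Mat) = 0
      · rw [h0]; simp
      · exact (rank_eq_one hd h0).le
  have h2 : pol (A - B) (A - B) = pol (B - A) (B - A) := by
    rw [← neg_sub B A, pol_neg, pol_comm, pol_neg, neg_neg]
  rw [h2, ← h]
  rfl

theorem coherent_line_fin (P : Proj) (a : ℝ) (A : H2) :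
    Coherent (line P a) (fin A) ↔ pol P.toH2 A = a := P.perp_mul_mul_perp_iff A a

theorem coherent_fin_line (P : Proj) (a : ℝ) (A : H2) :
    Coherent (fin A) (line P a) ↔ pol P.toH2 A = a := P.perp_mul_mul_perp_iff A a

end HBar

namespace H2

/-- The adjugate of a hermitian matrix. -/
def adj (A : H2) : H2 :=
  ⟨(A : Mat).adjugate, by
    change (A : Mat).adjugateᴴ = _
    rw [Matrix.adjugate_conjTranspose, ← Matrix.star_eq_conjTranspose, A.2.star_eq]⟩

theorem adj_mk (p q x y : ℝ) : adj (mk p q x y) = mk q p (-x) (-y) := by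
  refine Subtype.ext ?_
  change Matrix.adjugate _ = _
  rw [Matrix.adjugate_fin_two]
  ext i j
  fin_cases i <;> fin_cases j <;> simp [mk, Complex.ext_iff]

theorem adj_add (A B : H2) : adj (A + B) = adj A + adj B := by
  obtain ⟨p, q, x, y, rfl⟩ := exists_mk A
  obtain ⟨p', q', x', y', rfl⟩ := exists_mk B
  rw [adj_mk, adj_mk, mk_add, mk_add, adj_mk, mk_inj]
  refine ⟨?_, ?_, ?_, ?_⟩ <;> ring

theorem adj_smul (t : ℝ) (A : H2) : adj (t • A) = t • adj A := by
  obtain ⟨p, q, x, y, rfl⟩ := exists_mk A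
  rw [adj_mk, smul_mk, smul_mk, adj_mk, mk_inj]
  refine ⟨?_, ?_, ?_, ?_⟩ <;> ring

theorem adj_zero : adj 0 = 0 := by
  rw [← zero_smul ℝ 0, adj_smul, zero_smul, zero_smul]

theorem pol_adj (A B : H2) : pol (adj A) (adj B) = pol A B := by
  obtain ⟨p, q, x, y, rfl⟩ := exists_mk A
  obtain ⟨p', q', x', y', rfl⟩ := exists_mk B
  rw [adj_mk, adj_mk, pol_mk, pol_mk]
  ring

theorem adj_toH2 (P : Proj) : adj P.toH2 = P.perp.toH2 := by
  obtain ⟨p, q, x, y, h, h1, -⟩ := P.exists_mk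
  rw [Proj.perp_toH2 h h1, h, adj_mk]

end H2

namespace HBar

/-- The embedding of `H̄₂` into a quadric of the projective space over `ℝ × H₂ × ℝ`. -/
noncomputable def quadric : HBar → ℝ × H2 × ℝ
  | fin A => (pol A A / 2, A, 1)
  | line P a => (a, P.toH2, 0)
  | inf => (1, 0, 0)

/-- The bilinear form on `ℝ × H₂ × ℝ` that describes coherency. -/
def form (u v : ℝ × H2 × ℝ) : ℝ := u.1 * v.2.2 + u.2.2 * v.1 - pol u.2.1 v.2.1

/-- The isometry of `form` that induces the inversion. -/
def swapAdj (u : ℝ × H2 × ℝ) : ℝ × H2 × ℝ := (u.2.2, adj u.2.1, u.1)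

/-- For two matrices the form equals `det A + det B - pol A B = det (A - B)`; for a matrix and a
line it is `a - pol P A`. All clauses of the coherency relation thus become one orthogonality
condition. -/
theorem coherent_iff (X Y : HBar) : Coherent X Y ↔ form (quadric X) (quadric Y) = 0 := by
  cases X with
  | fin A =>
    cases Y with
    | fin B =>
      rw [coherent_fin_fin]
      simp only [form, quadric, pol_sub, pol_comm (A - B)]
      rw [pol_comm B A]
      constructor <;> intro h <;> linarith
    | line P a =>
      rw [coherent_fin_line]
      simp only [form, quadric, pol_comm A]
      constructor <;> intro h <;> linarith
    | inf => simp [form, quadric, Coherent, pol_zero]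
  | line P a =>
    cases Y with
    | fin B =>
      rw [coherent_line_fin]
      simp only [form, quadric]
      constructor <;> intro h <;> linarith
    | line Q b =>
      simp [form, quadric, Proj.pol_eq_zero_iff, Coherent]
    | inf => simp [form, quadric, Coherent, pol_zero]
  | inf =>
    cases Y <;> simp [form, quadric, Coherent, pol_comm 0, pol_zero]

theorem form_smul_swapAdj (k l : ℝ) (u v : ℝ × H2 × ℝ) :
    form (k • swapAdj u) (l • swapAdj v) = k * l * form u v := by
  simp only [form, swapAdj, Prod.smul_mk, smul_eq_mul, smul_pol, pol_smul, pol_adj]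
  ring

/-- For invertible `A` this is `A⁻¹ = (det A)⁻¹ adj A`: the triple `(1, adj A, det A)` divided by
`det A`. In the degenerate cases the scalar is the inverse of the one finite nonzero eigenvalue, or
`1` if there is none. -/
theorem quadric_inv (X : HBar) : ∃ k : ℝ, k ≠ 0 ∧ quadric (inv X) = k • swapAdj (quadric X) := by
  obtain ⟨P, a, b, rfl⟩ := exists_formalSum X
  rw [inv_formalSum]
  have hpq : ∀ a b : ℝ, pol (a • P.toH2 + b • P.perp.toH2) (a • P.toH2 + b • P.perp.toH2) / 2
      = a * b := by
    intro a b
    have h := det_sum P a b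
    rw [det_eq] at h
    exact_mod_cast h
  induction a using OnePoint.rec with
  | infty =>
    induction b using OnePoint.rec with
    | infty =>
      exact ⟨1, one_ne_zero, by simp [formalSum, extInv, quadric, swapAdj, adj_zero, pol_zero]⟩
    | coe b =>
      by_cases hb : b = 0
      · exact ⟨1, one_ne_zero, by simp [formalSum, extInv, quadric, swapAdj, adj_toH2, hb]⟩
      · refine ⟨b⁻¹, inv_ne_zero hb, ?_⟩
        simp only [formalSum, extInv, if_neg hb, quadric, hpq]
        simp [swapAdj, adj_toH2, hb]
  | coe a =>
    induction b using OnePoint.rec with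
    | infty =>
      by_cases ha : a = 0
      · exact ⟨1, one_ne_zero, by
          simp [formalSum, extInv, quadric, swapAdj, adj_toH2, ha, perp_perp]⟩
      · refine ⟨a⁻¹, inv_ne_zero ha, ?_⟩
        simp only [formalSum, extInv, if_neg ha, quadric, hpq]
        simp [swapAdj, adj_toH2, ha, perp_perp]
    | coe b =>
      by_cases ha : a = 0 <;> by_cases hb : b = 0
      · exact ⟨1, one_ne_zero, by
          simp [formalSum, extInv, quadric, swapAdj, adj_zero, ha, hb, pol_zero]⟩
      · refine ⟨b⁻¹, inv_ne_zero hb, ?_⟩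
        simp only [formalSum, extInv, if_neg hb, if_pos ha, quadric, hpq]
        simp [swapAdj, adj_toH2, adj_smul, hb, ha, perp_perp]
      · refine ⟨a⁻¹, inv_ne_zero ha, ?_⟩
        simp only [formalSum, extInv, if_neg ha, if_pos hb, quadric, hpq]
        simp [swapAdj, adj_toH2, adj_smul, hb, ha]
      · refine ⟨(a * b)⁻¹, inv_ne_zero (mul_ne_zero ha hb), ?_⟩
        simp only [formalSum, extInv, if_neg ha, if_neg hb, quadric, hpq]
        simp only [swapAdj, adj_toH2, adj_add, adj_smul, perp_perp, Prod.smul_mk, smul_add,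
          smul_smul, smul_eq_mul, mul_one, mul_inv]
        rw [Prod.mk.injEq, Prod.mk.injEq]
        refine ⟨rfl, ?_, ?_⟩
        · rw [add_comm]
          congr 2 <;> field_simp
        · field_simp

theorem inv_inv (X : HBar) : inv (inv X) = X := by
  have h : ∀ a : OnePoint ℝ, extInv (extInv a) = a := by
    intro a
    induction a using OnePoint.rec with
    | infty => simp [extInv]
    | coe a => by_cases ha : a = 0 <;> simp [extInv, ha]
  obtain ⟨P, a, b, rfl⟩ := exists_formalSum X
  rw [inv_formalSum, inv_formalSum, h, h]

theorem isAutomorphism_inv : IsAutomorphism inv := by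
  refine ⟨Function.Involutive.bijective inv_inv, fun X Y => ?_⟩
  obtain ⟨k, hk, hX⟩ := quadric_inv X
  obtain ⟨l, hl, hY⟩ := quadric_inv Y
  rw [coherent_iff, coherent_iff, hX, hY, form_smul_swapAdj]
  simp [hk, hl]

/-! ### Translations, congruences and the hyperplanes attached to lines. -/

theorem line_add (P : Proj) (a : ℝ) (B : H2) :
    add (line P a) B = line P (a + pol P.toH2 B) := by
  simp only [add, Proj.trace_perp_mul, Complex.ofReal_re]

theorem add_add (X : HBar) (A B : H2) : add (add X A) B = add X (A + B) := by
  cases X with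
  | fin C => simp only [add]; rw [add_assoc]
  | line P a => simp only [line_add, pol_add]; rw [add_assoc]
  | inf => rfl

theorem add_zero (X : HBar) : add X 0 = X := by
  cases X with
  | fin C => simp only [add]; rw [_root_.add_zero]
  | line P a => simp only [line_add, pol_zero]; rw [_root_.add_zero]
  | inf => rfl

theorem isAutomorphism_add (B : H2) : IsAutomorphism (fun X => add X B) := by
  refine ⟨Function.bijective_iff_has_inverse.2 ⟨fun X => add X (-B), fun X => ?_, fun X => ?_⟩,
    fun X Y => ?_⟩
  · simp only [add_add, add_neg_cancel, add_zero]
  · simp only [add_add, neg_add_cancel, add_zero]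
  · cases X <;> cases Y <;>
      simp only [coherent_fin_fin, coherent_fin_line, coherent_line_fin, add,
        Proj.trace_perp_mul, Complex.ofReal_re, add_sub_add_right_eq_sub, pol_add,
        add_left_inj] <;> rfl

theorem IsAutomorphism.comp {φ ψ : HBar → HBar} (hφ : IsAutomorphism φ) (hψ : IsAutomorphism ψ) :
    IsAutomorphism (φ ∘ ψ) :=
  ⟨hφ.1.comp hψ.1, fun X Y => (hψ.2 X Y).trans (hφ.2 _ _)⟩

theorem conj_one (X : HBar) : conj 1 X = X := by
  cases X with
  | fin A => simp only [conj, H2.conj_one]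
  | line P a =>
    have h : P.conj 1 = P := by
      refine ofRankOne_smul P one_ne_zero _ ?_ _ _
      rw [H2.conj_one, one_smul]
    simp only [conj, h]
    have h1 : (P.perp.1 * ((1 : GL (Fin 2) ℂ).1 * (1 : GL (Fin 2) ℂ).1ᴴ)).trace = 1 := by
      simp [P.perp.trace_eq_one]
    rw [h1]
    simp
  | inf => rfl

theorem isAffineAutomorphism_add (B : H2) : IsAffineAutomorphism (fun X => add X B) :=
  ⟨isAutomorphism_add B, 1, 1, B, Or.inl fun X => by simp [signMul, conj_one]⟩

end HBar

namespace Proj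

theorem pol_one (P : Proj) : pol P.toH2 1 = 1 := by
  have h := P.trace_perp_mul 1
  have h1 : ((1 : H2) : Mat) = 1 := rfl
  rw [h1, mul_one, P.perp.trace_eq_one] at h
  exact_mod_cast h.symm

/-- With `S P S^* = t Q`, the value at `S A S^*` is `|det S|² / t` times the old one. Taking `A = 1`
identifies this factor with the one used to extend the congruence to lines. -/
theorem pol_conj (S : GL (Fin 2) ℂ) (P : Proj) (A : H2) :
    pol (P.conj S).toH2 (A.conj S) = pol P.toH2 A * pol (P.conj S).toH2 (H2.conj S 1) := by
  obtain ⟨t, ht, -, h⟩ : ∃ t : ℝ, t ≠ 0 ∧ _ ∧ t • (P.conj S).toH2 = H2.conj S P.toH2 :=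
    toH2_ofRankOne _ _
  have key : ∀ B, t * pol (P.conj S).toH2 (B.conj S) = Complex.normSq S.1.det * pol P.toH2 B := by
    intro B
    rw [← smul_pol, h, H2.pol_conj]
  have h1 := key A
  have h2 := key 1
  rw [pol_one] at h2
  refine mul_left_cancel₀ ht ?_
  linear_combination h1 - pol P.toH2 A * h2

/-- Inclusion of null hyperplanes is equality: the points `a P^⊥` and `a P^⊥ + P` both lie on the
first one, so the second contains the direction `P`, and `pol Q P = 0` forces `Q = P`. -/
theorem eq_of_pol_imp {P Q : Proj} {a b : ℝ}
    (h : ∀ A, pol P.toH2 A = a → pol Q.toH2 A = b) : P = Q ∧ a = b := by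
  have hp : pol P.toH2 P.perp.toH2 = 1 := by
    have h1 := P.pol_one
    have h2 : (1 : H2) = P.toH2 + P.perp.toH2 := Subtype.ext (add_sub_cancel P.1 1).symm
    rwa [h2, pol_add, P.pol_self, zero_add] at h1
  have h1 := h (a • P.perp.toH2) (by rw [pol_smul, hp, mul_one])
  have h2 := h (a • P.perp.toH2 + P.toH2) (by rw [pol_add, pol_smul, hp, P.pol_self]; ring)
  rw [pol_add, h1] at h2
  obtain rfl := (pol_eq_zero_iff Q P).1 (by linarith)
  rw [pol_smul, hp] at h1
  exact ⟨rfl, by linarith⟩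

end Proj

/-! ### Automorphisms fixing `inf` are determined on `H2`. -/

namespace HBar

/-- A map that sends lines to lines, points of `H₂` to points of `H₂`, and preserves the
coherency between them. -/
def PreservesLines (ψ : HBar → HBar) : Prop :=
  (∀ A, ∃ B, ψ (fin A) = fin B) ∧ (∀ P a, ∃ Q b, ψ (line P a) = line Q b) ∧
    (ψ inf = inf) ∧ ∀ P a A, Coherent (line P a) (fin A) → Coherent (ψ (line P a)) (ψ (fin A))

theorem PreservesLines.comp {φ ψ : HBar → HBar} (hφ : PreservesLines φ) (hψ : PreservesLines ψ) :
    PreservesLines (fun X => φ (ψ X)) := by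
  obtain ⟨h1, h2, h3, h4⟩ := hφ
  obtain ⟨k1, k2, k3, k4⟩ := hψ
  refine ⟨fun A => ?_, fun P a => ?_, by simp only [k3, h3], fun P a A h => ?_⟩
  · obtain ⟨B, hB⟩ := k1 A
    simp only [hB, h1]
  · obtain ⟨Q, b, hQ⟩ := k2 P a
    simp only [hQ, h2]
  · have := k4 P a A h
    obtain ⟨B, hB⟩ := k1 A
    obtain ⟨Q, b, hQ⟩ := k2 P a
    rw [hB, hQ] at this
    simp only [hB, hQ]
    exact h4 _ _ _ this

theorem preservesLines_add (B : H2) : PreservesLines (fun X => add X B) :=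
  ⟨fun A => ⟨A + B, rfl⟩, fun P a => ⟨P, _, line_add P a B⟩, rfl,
    fun P a A => ((isAutomorphism_add B).2 (line P a) (fin A)).1⟩

theorem preservesLines_transpose : PreservesLines transpose := by
  refine ⟨fun A => ⟨A.transpose, rfl⟩, fun P a => ⟨P.transpose, a, rfl⟩, rfl, fun P a A h => ?_⟩
  simp only [transpose, coherent_line_fin] at h ⊢
  have hP : P.transpose.toH2 = P.toH2.transpose := rfl
  rw [hP, pol_transpose, h]

theorem preservesLines_signMul (c : ℤˣ) : PreservesLines (signMul c) := by
  rcases Int.units_eq_one_or c with rfl | rfl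
  · exact ⟨fun A => ⟨A, rfl⟩, fun P a => ⟨P, a, rfl⟩, rfl, fun _ _ _ h => h⟩
  · refine ⟨fun A => ⟨-A, rfl⟩, fun P a => ⟨P, -a, rfl⟩, rfl, fun P a A h => ?_⟩
    change Coherent (line P (-a)) (fin (-A))
    rw [coherent_line_fin] at h ⊢
    rw [pol_neg, h]

theorem preservesLines_conj (S : GL (Fin 2) ℂ) : PreservesLines (conj S) := by
  refine ⟨fun A => ⟨A.conj S, rfl⟩, fun P a => ⟨P.conj S, _, rfl⟩, rfl, fun P a A h => ?_⟩
  simp only [conj, coherent_line_fin] at h ⊢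
  have h1 := (P.conj S).trace_perp_mul (H2.conj S 1)
  have h2 : ((H2.conj S 1 : H2) : Mat) = S.1 * S.1ᴴ := by simp [H2.conj]
  rw [h2] at h1
  rw [h1, Complex.ofReal_re, Proj.pol_conj, h]

theorem IsAutomorphism.exists_fin {φ : HBar → HBar} (hφ : IsAutomorphism φ) (h : φ inf = inf)
    (A : H2) : ∃ B, φ (fin A) = fin B := by
  have hc : ¬ Coherent inf (φ (fin A)) := fun hc =>
    ((hφ.2 inf (fin A)).2 (by rwa [h]) : Coherent inf (fin A)).elim
  cases hX : φ (fin A) with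
  | fin B => exact ⟨B, rfl⟩
  | line R d => rw [hX] at hc; exact (hc trivial).elim
  | inf => rw [hX] at hc; exact (hc trivial).elim

theorem IsAutomorphism.exists_line {φ : HBar → HBar} (hφ : IsAutomorphism φ) (h : φ inf = inf)
    (P : Proj) (a : ℝ) : ∃ Q b, φ (line P a) = line Q b := by
  have hc := (hφ.2 inf (line P a)).1 trivial
  rw [h] at hc
  cases hX : φ (line P a) with
  | fin A => rw [hX] at hc; exact hc.elim
  | line R d => exact ⟨R, d, rfl⟩
  | inf => exact absurd (hφ.1.1 (hX.trans h.symm)) (by simp)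

/-- A line is determined by the matrices coherent to it. Every matrix on the hyperplane of `φ (line
P a)` is the image of a matrix coherent to `line P a`, so it also lies on the hyperplane of `ψ (line
P a)`. -/
theorem eq_of_eq_on_fin {φ ψ : HBar → HBar} (hφ : IsAutomorphism φ) (h : φ inf = inf)
    (hψ : PreservesLines ψ) (heq : ∀ A, φ (fin A) = ψ (fin A)) (X : HBar) : φ X = ψ X := by
  obtain ⟨h1, h2, h3, h4⟩ := hψ
  cases X with
  | fin A => exact heq A
  | inf => rw [h, h3]
  | line P a =>
    obtain ⟨Q, b, hQ⟩ := h2 P a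
    obtain ⟨R, d, hR⟩ := hφ.exists_line h P a
    have hRQ : R = Q ∧ d = b := by
      refine Proj.eq_of_pol_imp fun B hB => ?_
      obtain ⟨Y, hY⟩ := hφ.1.2 (fin B)
      have hc : Coherent (line P a) Y := (hφ.2 _ _).2 (by
        rw [hY, hR, coherent_line_fin, hB])
      cases Y with
      | fin A =>
        have := h4 P a A hc
        rwa [hQ, ← heq, hY, coherent_line_fin] at this
      | line R' d' =>
        obtain rfl : P = R' := hc
        have : Coherent inf (fin B) := by
          rw [← h, ← hY]
          exact (hφ.2 inf (line P d')).1 trivial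
        exact this.elim
      | inf => rw [h] at hY; exact absurd hY (by simp)
    rw [hQ, hR, hRQ.1, hRQ.2]

end HBar

/-! ### Definite matrices, null frames and additive functions. -/

namespace H2

/-- A hermitian matrix that vanishes on no rank one projection has positive determinant. -/
theorem pol_self_pos {B : H2} (h : ∀ R : Proj, pol R.toH2 B ≠ 0) : 0 < pol B B := by
  obtain ⟨p, q, x, y, rfl⟩ := exists_mk B
  by_contra hle
  rw [pol_mk] at hle
  push Not at hle
  have key : ∀ r s u v : ℝ, r + s ≠ 0 → r * s = u ^ 2 + v ^ 2 →
      r * q + s * p - 2 * (u * x + v * y) ≠ 0 := by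
    intro r s u v h1 h2 h3
    obtain ⟨R, hR⟩ := Proj.exists_smul_toH2_eq_mk h1 h2
    refine h R (mul_left_cancel₀ h1 ?_)
    rw [← smul_pol, hR, pol_mk, h3, mul_zero]
  by_cases hp : p = 0
  · subst hp
    by_cases hz : x ^ 2 + y ^ 2 = 0
    · have hx : x = 0 := by nlinarith [sq_nonneg x, sq_nonneg y]
      have hy : y = 0 := by nlinarith [sq_nonneg x, sq_nonneg y]
      exact key 0 1 0 0 (by norm_num) (by norm_num) (by rw [hx, hy]; ring)
    · refine key 1 ((q * x / (2 * (x ^ 2 + y ^ 2))) ^ 2 + (q * y / (2 * (x ^ 2 + y ^ 2))) ^ 2)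
        (q * x / (2 * (x ^ 2 + y ^ 2))) (q * y / (2 * (x ^ 2 + y ^ 2))) (by positivity) (by ring) ?_
      field_simp
      ring
  -- With `r = 1`, `s = |w|²` and `z = x + iy`, the equation to solve is the circle `|w - z / p| = d
  -- / |p|`; the witness is `w = (z + d) / p`.
  · set d := Real.sqrt (x ^ 2 + y ^ 2 - p * q)
    have hd : d ^ 2 = x ^ 2 + y ^ 2 - p * q := Real.sq_sqrt (by linarith)
    refine key 1 (((x + d) / p) ^ 2 + (y / p) ^ 2) ((x + d) / p) (y / p) (by positivity)
      (by ring) ?_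
    field_simp
    linear_combination hd

/-- A hermitian matrix with positive determinant is definite. -/
theorem pol_mul_pol_pos {B : H2} (h : 0 < pol B B) (R R' : Proj) :
    0 < pol R.toH2 B * pol R'.toH2 B := by
  obtain ⟨p, q, x, y, rfl⟩ := exists_mk B
  rw [pol_mk] at h
  have hp : p ≠ 0 := by
    rintro rfl
    nlinarith [sq_nonneg x, sq_nonneg y]
  have key : ∀ R : Proj, 0 < pol R.toH2 (mk p q x y) * p := by
    intro R
    obtain ⟨r, s, u, v, hR, h1, h2⟩ := R.exists_mk
    rw [hR, pol_mk]
    have hr : 0 ≤ r := by nlinarith [sq_nonneg u, sq_nonneg v, sq_nonneg r]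
    rcases hr.eq_or_lt with rfl | hr
    · have hu : u = 0 := by nlinarith [sq_nonneg u, sq_nonneg v]
      have hv : v = 0 := by nlinarith [sq_nonneg u, sq_nonneg v]
      obtain rfl : s = 1 := by linarith
      rw [hu, hv]
      have : 0 < p ^ 2 := by positivity
      nlinarith
    · refine pos_of_mul_pos_right (a := r) ?_ hr.le
      -- Completing the square after multiplication by `r`, with `r * s = u ^ 2 + v ^ 2`.
      have h3 : r * ((r * q + s * p - 2 * (u * x + v * y)) * p)
          = r ^ 2 * (p * q - x ^ 2 - y ^ 2) + (r * x - p * u) ^ 2 + (r * y - p * v) ^ 2 := by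
        linear_combination p ^ 2 * h2
      rw [h3]
      have : 0 < r ^ 2 * (p * q - x ^ 2 - y ^ 2) := mul_pos (by positivity) (by linarith)
      positivity
  refine pos_of_mul_pos_left (b := p ^ 2) ?_ (sq_nonneg p)
  have := mul_pos (key R) (key R')
  linarith

/-- Four hermitian matrices on which all tuples of values are attained are the coordinates of a
linear parametrization of `H₂`. -/
theorem exists_leftInverse_pol {Q : Fin 4 → H2}
    (hQ : ∀ y : Fin 4 → ℝ, ∃ B, ∀ i, pol (Q i) B = y i) :
    ∃ e : (Fin 4 → ℝ) →ₗ[ℝ] H2, ∀ B, e (fun i => pol (Q i) B) = B := by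
  let M : (Fin 4 → ℝ) →ₗ[ℝ] H2 :=
    { toFun := fun v => mk (v 0) (v 1) (v 2) (v 3)
      map_add' := fun v w => (mk_add _ _ _ _ _ _ _ _).symm
      map_smul' := fun t v => (smul_mk _ _ _ _ _).symm }
  have hM : Function.Surjective M := fun B => by
    obtain ⟨p, q, x, y, rfl⟩ := exists_mk B
    exact ⟨![p, q, x, y], rfl⟩
  let L : (Fin 4 → ℝ) →ₗ[ℝ] (Fin 4 → ℝ) :=
    { toFun := fun v i => pol (Q i) (M v)
      map_add' := fun v w => funext fun i => by rw [map_add, pol_add]; rfl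
      map_smul' := fun t v => funext fun i => by rw [map_smul, pol_smul]; rfl }
  have hL : Function.Surjective L := fun y => by
    obtain ⟨B, hB⟩ := hQ y
    obtain ⟨v, rfl⟩ := hM B
    exact ⟨v, funext hB⟩
  let e := LinearEquiv.ofBijective L ⟨LinearMap.injective_iff_surjective.2 hL, hL⟩
  refine ⟨M ∘ₗ e.symm.toLinearMap, fun B => ?_⟩
  obtain ⟨v, rfl⟩ := hM B
  have : e.symm (e v) = v := e.symm_apply_apply v
  exact congrArg M this

end H2

/-- Four projections forming a basis, and a fifth whose coefficients in that basis are all nonzero.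
These coefficients will link all five functions `f P` in one functional equation. -/
theorem Proj.exists_frame : ∃ (E : Fin 4 → Proj) (F : Proj),
    (E 0).toH2 = mk 1 0 0 0 ∧ (E 1).toH2 = mk 0 1 0 0 ∧
    (∀ A, pol F.toH2 A = ∑ i, ![2 / 3, 1 / 3, 2 / 3, -2 / 3] i * pol (E i).toH2 A) ∧
    (∀ y : Fin 4 → ℝ, ∃ A, ∀ i, pol (E i).toH2 A = y i) := by
  obtain ⟨E0, h0⟩ := exists_toH2_eq_mk (p := 1) (q := 0) (x := 0) (y := 0) (by norm_num)
    (by norm_num)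
  obtain ⟨E1, h1⟩ := exists_toH2_eq_mk (p := 0) (q := 1) (x := 0) (y := 0) (by norm_num)
    (by norm_num)
  obtain ⟨E2, h2⟩ := exists_toH2_eq_mk (p := 1 / 2) (q := 1 / 2) (x := 1 / 2) (y := 0)
    (by norm_num) (by norm_num)
  obtain ⟨E3, h3⟩ := exists_toH2_eq_mk (p := 1 / 2) (q := 1 / 2) (x := 0) (y := 1 / 2)
    (by norm_num) (by norm_num)
  obtain ⟨F, hF⟩ := exists_toH2_eq_mk (p := 2 / 3) (q := 1 / 3) (x := 1 / 3) (y := -1 / 3)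
    (by norm_num) (by norm_num)
  refine ⟨![E0, E1, E2, E3], F, h0, h1, fun A => ?_, fun y => ?_⟩
  · obtain ⟨p, q, x, y, rfl⟩ := H2.exists_mk A
    simp [Fin.sum_univ_four, h0, h1, h2, h3, hF, pol_mk]
    ring
  · refine ⟨mk (y 1) (y 0) ((y 0 + y 1) / 2 - y 2) ((y 0 + y 1) / 2 - y 3), fun i => ?_⟩
    fin_cases i <;> simp [h0, h1, h2, h3, pol_mk] <;> ring

/-- An additive real function that is positive on positive numbers is linear. -/
theorem map_mul_of_additive_of_pos {f : ℝ → ℝ} (hadd : ∀ s t, f (s + t) = f s + f t)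
    (hpos : ∀ t, 0 < t → 0 < f t) (r t : ℝ) : f (r * t) = r * f t := by
  let F : ℝ →+ ℝ := AddMonoidHom.mk' f hadd
  have hrat : ∀ q : ℚ, f q = q * f 1 := by
    intro q
    have := map_rat_smul F q 1
    simpa [F, Rat.smul_def] using this
  have hmono : ∀ s t, s < t → f s < f t := by
    intro s t hst
    have h1 := hpos (t - s) (by linarith)
    have h2 := hadd s (t - s)
    rw [add_sub_cancel] at h2
    linarith
  have h1 := hpos 1 one_pos
  have key : ∀ r, f r = r * f 1 := by
    intro r
    rcases lt_trichotomy (f r) (r * f 1) with h | h | h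
    · obtain ⟨q, hq1, hq2⟩ := exists_rat_btwn ((div_lt_iff₀ h1).2 h)
      have h2 := hmono _ _ hq2
      rw [hrat] at h2
      rw [div_lt_iff₀ h1] at hq1
      linarith
    · exact h
    · obtain ⟨q, hq1, hq2⟩ := exists_rat_btwn ((lt_div_iff₀ h1).2 h)
      have h2 := hmono _ _ hq1
      rw [hrat] at h2
      rw [lt_div_iff₀ h1] at hq2
      linarith
  rw [key, key t, mul_assoc]

/-! ### Linear maps preserving singularity. -/

namespace H2

/-- A positive semidefinite singular matrix has the form `s s^*`. -/
theorem exists_eq_vec_mul_conj {X : H2} (h : pol X X = 0) (hpos : ∀ R : Proj, 0 ≤ pol R.toH2 X) :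
    ∃ a b : ℂ, (X : Mat) = !![a * star a, a * star b; b * star a, b * star b] := by
  obtain ⟨p, q, x, y, rfl⟩ := exists_mk X
  rw [pol_mk] at h
  obtain ⟨E, F, h0, h1, -⟩ := Proj.exists_frame
  have hq := hpos (E 0)
  have hp := hpos (E 1)
  rw [h0, pol_mk] at hq
  rw [h1, pol_mk] at hp
  replace hq : 0 ≤ q := by linarith
  replace hp : 0 ≤ p := by linarith
  rcases hp.eq_or_lt with rfl | hp
  · have hx : x = 0 := by nlinarith [sq_nonneg x, sq_nonneg y]
    have hy : y = 0 := by nlinarith [sq_nonneg x, sq_nonneg y]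
    subst hx hy
    refine ⟨0, (Real.sqrt q : ℂ), ?_⟩
    have := Real.mul_self_sqrt hq
    ext i j
    fin_cases i <;> fin_cases j <;> simp [mk, Complex.ext_iff]
    linarith
  · have hs := Real.mul_self_sqrt hp.le
    have hs0 : Real.sqrt p ≠ 0 := (Real.sqrt_pos.2 hp).ne'
    -- The first column of the matrix divided by `√p`; singularity then fixes the last entry `q`.
    refine ⟨(Real.sqrt p : ℂ), ⟨x / Real.sqrt p, -y / Real.sqrt p⟩, ?_⟩
    set s := Real.sqrt p
    have hq' : q = x / s * (x / s) + -y / s * (-y / s) := by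
      field_simp
      linear_combination h / 2 + q * hs
    ext i j
    fin_cases i <;> fin_cases j <;> simp [mk, Complex.ext_iff]
    · exact hs.symm
    · constructor <;> field_simp
    · constructor <;> field_simp
    · exact ⟨by rw [hq'], by ring⟩

/-- Linear maps that preserve singularity and fix two orthogonal projections. -/
theorem exists_conj_of_fixed {ψ : H2 → H2} (hadd : ∀ A B, ψ (A + B) = ψ A + ψ B)
    (hsmul : ∀ (t : ℝ) A, ψ (t • A) = t • ψ A) (h0 : ψ (mk 1 0 0 0) = mk 1 0 0 0)
    (h1 : ψ (mk 0 1 0 0) = mk 0 1 0 0) (hdet : ∀ A, pol A A = 0 → pol (ψ A) (ψ A) = 0) :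
    ∃ U : GL (Fin 2) ℂ, (∀ A, ψ A = conj U A) ∨ (∀ A, ψ A = conj U A.transpose) := by
  obtain ⟨p, q, a, b, hX⟩ := exists_mk (ψ (mk 0 0 1 0))
  obtain ⟨p', q', a', b', hY⟩ := exists_mk (ψ (mk 0 0 0 1))
  have hψ : ∀ r s x y, ψ (mk r s x y) = mk (r + x * p + y * p') (s + x * q + y * q')
      (x * a + y * a') (x * b + y * b') := by
    intro r s x y
    have : mk r s x y = r • mk 1 0 0 0 + s • mk 0 1 0 0 + x • mk 0 0 1 0 + y • mk 0 0 0 1 := by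
      simp [smul_mk, mk_add]
    rw [this, hadd, hadd, hadd, hsmul, hsmul, hsmul, hsmul, h0, h1, hX, hY]
    simp only [smul_mk, mk_add, mk_inj]
    refine ⟨?_, ?_, ?_, ?_⟩ <;> ring
  have key : ∀ x y : ℝ, (1 + x * p + y * p') * ((x ^ 2 + y ^ 2) + x * q + y * q')
      = (x * a + y * a') ^ 2 + (x * b + y * b') ^ 2 := by
    intro x y
    have := hdet (mk 1 (x ^ 2 + y ^ 2) x y) (by rw [pol_mk]; ring)
    rw [hψ, pol_mk] at this
    linear_combination this / 2
  -- On each axis `key` is a cubic identity in one variable; four sample points suffice to kill `p,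
  -- q` and `p', q'`, leaving an isometry of the off-diagonal plane.
  have k1 := key 1 0
  have k2 := key (-1) 0
  have k3 := key 2 0
  have k4 := key (-2) 0
  have l1 := key 0 1
  have l2 := key 0 (-1)
  have l3 := key 0 2
  have l4 := key 0 (-2)
  have hp : p = 0 := by linarith
  have hq : q = 0 := by rw [hp] at k1 k2; linarith
  have hp' : p' = 0 := by linarith
  have hq' : q' = 0 := by rw [hp'] at l1 l2; linarith
  subst hp hq hp' hq'
  have m := key 1 1
  have e1 : a ^ 2 + b ^ 2 = 1 := by linarith
  have e2 : a' ^ 2 + b' ^ 2 = 1 := by linarith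
  have e3 : a * a' + b * b' = 0 := by linarith
  have hU : IsUnit (!![(⟨a, b⟩ : ℂ), 0; 0, 1] : Mat) := by
    rw [Matrix.isUnit_iff_isUnit_det, isUnit_iff_ne_zero, Matrix.det_fin_two]
    simp [Complex.ext_iff]
    rintro rfl rfl
    norm_num at e1
  obtain ⟨U, hU⟩ := hU
  have hconj : ∀ r s x y, conj U (mk r s x y) = mk r s (a * x - b * y) (a * y + b * x) := by
    intro r s x y
    refine Subtype.ext ?_
    change U.1 * _ * U.1ᴴ = _
    rw [hU]
    ext i j
    fin_cases i <;> fin_cases j <;>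
      simp [mk, Matrix.mul_apply, Fin.sum_univ_two, Complex.ext_iff] <;> grind
  -- An orthogonal matrix of the plane has determinant `1` or `-1`: a rotation is a congruence, a
  -- reflection is one after transposition.
  have hdiv : (a * b' - b * a' - 1) * (a * b' - b * a' + 1) = 0 := by grind
  refine ⟨U, ?_⟩
  rcases mul_eq_zero.1 hdiv with h | h
  · have ea : a' = -b := by grind
    have eb : b' = a := by grind
    subst ea eb
    refine Or.inl fun A => ?_
    obtain ⟨r, s, x, y, rfl⟩ := exists_mk A
    rw [hψ, hconj, mk_inj]
    refine ⟨?_, ?_, ?_, ?_⟩ <;> ring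
  · have ea : a' = b := by grind
    have eb : b' = -a := by grind
    subst ea eb
    refine Or.inr fun A => ?_
    obtain ⟨r, s, x, y, rfl⟩ := exists_mk A
    rw [hψ, transpose_mk, hconj, mk_inj]
    refine ⟨?_, ?_, ?_, ?_⟩ <;> ring

end H2
-- Rigidity of maps permuting the null hyperplanes.
/-- The maps of `H₂` that permute the null hyperplanes `pol P A = a`, and preserve `0` and
singularity. -/
structure NullMap (φ : H2 → H2) (π : Proj → Proj) (f : Proj → ℝ → ℝ) : Prop where
  surj : Function.Surjective π
  bij : ∀ P, Function.Bijective (f P)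
  map_zero : ∀ P, f P 0 = 0
  pol_map : ∀ P A, pol (π P).toH2 (φ A) = f P (pol P.toH2 A)
  singular : ∀ A, pol A A = 0 → pol (φ A) (φ A) = 0

namespace NullMap

variable {φ : H2 → H2} {π : Proj → Proj} {f : Proj → ℝ → ℝ}

theorem map_ne_zero (h : NullMap φ π f) (P : Proj) {t : ℝ} (ht : t ≠ 0) : f P t ≠ 0 :=
  fun h0 => ht ((h.bij P).1 (h0.trans (h.map_zero P).symm))

/-- Definiteness means that no projection pairs to zero with the matrix. This passes to `φ A`, as
`π` is onto and `f P` vanishes only at `0`. -/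
theorem pol_self_pos (h : NullMap φ π f) {A : H2} (hA : 0 < pol A A) : 0 < pol (φ A) (φ A) := by
  refine H2.pol_self_pos fun R => ?_
  obtain ⟨P, rfl⟩ := h.surj R
  rw [h.pol_map]
  refine h.map_ne_zero P fun h0 => ?_
  have := pol_mul_pol_pos hA P P
  simp [h0] at this

theorem mul_pos (h : NullMap φ π f) {A : H2} (hA : 0 < pol A A) (P P' : Proj) :
    0 < f P (pol P.toH2 A) * f P' (pol P'.toH2 A) := by
  have := pol_mul_pol_pos (h.pol_self_pos hA) (π P) (π P')
  rwa [h.pol_map, h.pol_map] at this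

/-- All values of a definite matrix on projections share one sign. Images of diagonal matrices with
independent positive entries make the sign constant in `t`; images of `t • 1`, which takes the value
`t` on every projection, make it independent of `P`. -/
theorem pos_or_neg (h : NullMap φ π f) :
    (∀ P t, 0 < t → 0 < f P t) ∨ (∀ P t, 0 < t → f P t < 0) := by
  obtain ⟨E, -, h0, h1, -⟩ := Proj.exists_frame
  have k1 : ∀ s t, 0 < s → 0 < t → 0 < f (E 0) t * f (E 1) s := by
    intro s t hs ht
    have hp : 0 < s * t := _root_.mul_pos hs ht
    have := h.mul_pos (A := H2.mk s t 0 0) (by rw [pol_mk]; linarith) (E 0) (E 1)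
    rw [h0, h1, pol_mk, pol_mk] at this
    simpa using this
  have k2 : ∀ P t, 0 < t → 0 < f P t * f (E 1) t := by
    intro P t ht
    have h1 : 0 < pol (H2.mk t t 0 0) (H2.mk t t 0 0) := by rw [pol_mk]; nlinarith
    have := h.mul_pos h1 P (E 1)
    obtain ⟨p, q, x, y, hP, hpq, -⟩ := P.exists_mk
    obtain ⟨p', q', x', y', hP', hpq', -⟩ := (E 1).exists_mk
    have e : p * t + q * t - 2 * (x * 0 + y * 0) = t := by linear_combination t * hpq
    have e' : p' * t + q' * t - 2 * (x' * 0 + y' * 0) = t := by linear_combination t * hpq'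
    rwa [hP, hP', pol_mk, pol_mk, e, e'] at this
  rcases lt_or_gt_of_ne (h.map_ne_zero (E 0) one_ne_zero) with hneg | hpos
  · refine Or.inr fun P t ht => ?_
    nlinarith [k1 t 1 ht one_pos, k2 P t ht]
  · refine Or.inl fun P t ht => ?_
    have := pos_of_mul_pos_right (k1 t 1 ht one_pos) hpos.le
    exact pos_of_mul_pos_left (k2 P t ht) this.le

/-- The four frame values of `A` determine `φ A` linearly from the numbers `f (E i)`. Evaluating at
the fifth projection gives `f F (∑ c i * x i) = ∑ d i * f (E i) (x i)`, a Pexider equation, so all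
five functions are additive. Positivity is needed only for homogeneity. -/
theorem linear_of_pos (h : NullMap φ π f) (hpos : ∀ P t, 0 < t → 0 < f P t) :
    (∀ A B, φ (A + B) = φ A + φ B) ∧ ∀ (t : ℝ) A, φ (t • A) = t • φ A := by
  obtain ⟨E, F, -, -, hF, hE⟩ := Proj.exists_frame
  set c : Fin 4 → ℝ := ![2 / 3, 1 / 3, 2 / 3, -2 / 3] with hc
  have hc0 : ∀ i, c i ≠ 0 := by
    intro i
    fin_cases i <;> norm_num [hc]
  obtain ⟨e, he⟩ := exists_leftInverse_pol (Q := fun i => (π (E i)).toH2) fun y => by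
    choose x hx using fun i => (h.bij (E i)).2 (y i)
    obtain ⟨A, hA⟩ := hE x
    exact ⟨φ A, fun i => by rw [h.pol_map, hA, hx]⟩
  have hφ : ∀ A, φ A = e fun i => f (E i) (pol (E i).toH2 A) := by
    intro A
    rw [← he (φ A)]
    simp only [h.pol_map]
  have hrel : ∀ x : Fin 4 → ℝ,
      f F (∑ i, c i * x i) = pol (π F).toH2 (e fun i => f (E i) (x i)) := by
    intro x
    obtain ⟨A, hA⟩ := hE x
    have h1 := h.pol_map F A
    rw [hF, hφ] at h1
    simp only [hA] at h1
    exact h1.symm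
  let d : Fin 4 → ℝ := fun i => pol (π F).toH2 (e (Pi.single i 1))
  have hd : ∀ y : Fin 4 → ℝ, pol (π F).toH2 (e y) = ∑ i, y i * d i := by
    intro y
    conv_lhs => rw [pi_eq_sum_univ' y]
    simp only [map_sum, map_smul]
    simp only [Fin.sum_univ_four, pol_add, pol_smul, d]
  simp only [hd] at hrel
  have hsingle : ∀ i s, f F (c i * s) = f (E i) s * d i := by
    intro i s
    have := hrel (Pi.single i s)
    rw [Finset.sum_eq_single i (fun j _ hj => by simp [hj]) (by simp),
      Finset.sum_eq_single i (fun j _ hj => by simp [hj, h.map_zero]) (by simp)] at this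
    simpa using this
  have hFadd : ∀ s t, f F (s + t) = f F s + f F t := by
    intro s t
    -- Two active variables suffice: the weights `c` cancel and `hsingle` rewrites each summand
    -- through `f F`.
    have := hrel ![s / c 0, t / c 1, 0, 0]
    simp only [Fin.sum_univ_four] at this
    simp only [Matrix.cons_val, mul_zero, h.map_zero, zero_mul, add_zero, ← hsingle] at this
    rwa [mul_div_cancel₀ _ (hc0 0), mul_div_cancel₀ _ (hc0 1)] at this
  have hd0 : ∀ i, d i ≠ 0 := by
    intro i hi
    have := hsingle i 1
    rw [hi, mul_zero] at this
    exact h.map_ne_zero F (by simpa using hc0 i) this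
  have hadd : ∀ i s t, f (E i) (s + t) = f (E i) s + f (E i) t := by
    intro i s t
    refine mul_right_cancel₀ (hd0 i) ?_
    rw [add_mul, ← hsingle, ← hsingle, ← hsingle, mul_add, hFadd]
  refine ⟨fun A B => ?_, fun t A => ?_⟩
  · rw [hφ, hφ A, hφ B, ← map_add]
    congr 1
    funext i
    rw [pol_add, hadd]
    rfl
  · rw [hφ, hφ A, ← map_smul]
    congr 1
    funext i
    rw [pol_smul, map_mul_of_additive_of_pos (hadd i) (hpos (E i))]
    rfl

/-- The images of the two diagonal projections are positive semidefinite and singular, hence of the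
form `s s^*`. The two vectors are the columns of `S`, and `S⁻¹` brings the map to the case that
fixes both projections. -/
theorem exists_conj_of_pos (h : NullMap φ π f) (hpos : ∀ P t, 0 < t → 0 < f P t) :
    ∃ S : GL (Fin 2) ℂ, (∀ A, φ A = conj S A) ∨ (∀ A, φ A = conj S A.transpose) := by
  obtain ⟨hadd, hsmul⟩ := h.linear_of_pos hpos
  obtain ⟨E, -, h0, h1, -⟩ := Proj.exists_frame
  have hnn : ∀ P R : Proj, 0 ≤ pol R.toH2 (φ P.toH2) := by
    intro P R
    obtain ⟨R, rfl⟩ := h.surj R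
    rw [h.pol_map]
    rcases (Proj.pol_nonneg R P).eq_or_lt with h2 | h2
    · rw [← h2, h.map_zero]
    · exact (hpos R _ h2).le
  obtain ⟨a, b, hab⟩ := exists_eq_vec_mul_conj (h.singular _ (E 0).pol_self) (hnn (E 0))
  obtain ⟨a', b', hab'⟩ := exists_eq_vec_mul_conj (h.singular _ (E 1).pol_self) (hnn (E 1))
  rw [h0] at hab
  rw [h1] at hab'
  -- The image of the identity is definite; its determinant is `|det S|²`, so the columns are
  -- independent.
  have hI : pol (φ (H2.mk 1 0 0 0 + H2.mk 0 1 0 0)) (φ (H2.mk 1 0 0 0 + H2.mk 0 1 0 0)) ≠ 0 :=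
    (h.pol_self_pos (by rw [mk_add, pol_mk]; norm_num)).ne'
  have hS : IsUnit (!![a, a'; b, b'] : Mat) := by
    rw [Matrix.isUnit_iff_isUnit_det, isUnit_iff_ne_zero, Matrix.det_fin_two]
    intro hd
    refine hI ((det_eq_zero_iff _).1 ?_)
    rw [hadd]
    have : ((φ (H2.mk 1 0 0 0) + φ (H2.mk 0 1 0 0) : H2) : Mat)
        = !![a * star a, a * star b; b * star a, b * star b]
          + !![a' * star a', a' * star b'; b' * star a', b' * star b'] := by
      rw [← hab, ← hab']
      rfl
    rw [this, Matrix.det_fin_two]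
    simp at hd ⊢
    have hd' := congrArg star hd
    simp at hd'
    grind
  obtain ⟨S, hS⟩ := hS
  have e0 : φ (H2.mk 1 0 0 0) = conj S (H2.mk 1 0 0 0) := by
    refine Subtype.ext ?_
    rw [hab]
    change _ = S.1 * _ * S.1ᴴ
    rw [hS]
    ext i j
    fin_cases i <;> fin_cases j <;>
      simp [H2.mk, Matrix.mul_apply, Fin.sum_univ_two, Complex.ext_iff]
  have e1 : φ (H2.mk 0 1 0 0) = conj S (H2.mk 0 1 0 0) := by
    refine Subtype.ext ?_
    rw [hab']
    change _ = S.1 * _ * S.1ᴴ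
    rw [hS]
    ext i j
    fin_cases i <;> fin_cases j <;>
      simp [H2.mk, Matrix.mul_apply, Fin.sum_univ_two, Complex.ext_iff]
  obtain ⟨U, hU⟩ := exists_conj_of_fixed (ψ := fun A => conj S⁻¹ (φ A))
    (fun A B => by simp only [hadd, conj_add]) (fun t A => by simp only [hsmul, conj_smul])
    (by simp only [e0, conj_inv_conj]) (by simp only [e1, conj_inv_conj])
    (fun A hA => pol_conj_self _ (h.singular A hA))
  refine ⟨S * U, hU.imp (fun hU A => ?_) fun hU A => ?_⟩
  · rw [conj_mul, ← hU, conj_conj_inv]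
  · rw [conj_mul, ← hU, conj_conj_inv]

theorem neg (h : NullMap φ π f) : NullMap (fun A => -φ A) π (fun P t => -f P t) where
  surj := h.surj
  bij P := (Equiv.neg ℝ).bijective.comp (h.bij P)
  map_zero P := by rw [h.map_zero, neg_zero]
  pol_map P A := by rw [pol_neg, h.pol_map]
  singular A hA := by rw [pol_neg, pol_comm, pol_neg, neg_neg, h.singular A hA]

theorem exists_conj (h : NullMap φ π f) :
    ∃ (c : ℤˣ) (S : GL (Fin 2) ℂ),
      (∀ A, HBar.fin (φ A) = HBar.signMul c (HBar.fin (conj S A))) ∨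
      (∀ A, HBar.fin (φ A) = HBar.signMul c (HBar.fin (conj S A.transpose))) := by
  rcases h.pos_or_neg with hpos | hneg
  · obtain ⟨S, hS⟩ := h.exists_conj_of_pos hpos
    refine ⟨1, S, hS.imp (fun hS A => ?_) fun hS A => ?_⟩ <;> rw [hS] <;> rfl
  · obtain ⟨S, hS⟩ := h.neg.exists_conj_of_pos fun P t ht => neg_pos.2 (hneg P t ht)
    refine ⟨-1, S, hS.imp (fun hS A => ?_) fun hS A => ?_⟩ <;> rw [← hS] <;>
      simp [HBar.signMul, HBar.neg]

end NullMap

/-! ### From automorphisms to affine and standard maps. -/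

namespace HBar

theorem IsAutomorphism.exists_line_eq {φ : HBar → HBar} (hφ : IsAutomorphism φ) (h : φ inf = inf)
    (Q : Proj) (b : ℝ) : ∃ P a, φ (line P a) = line Q b := by
  obtain ⟨X, hX⟩ := hφ.1.2 (line Q b)
  cases X with
  | fin A =>
    obtain ⟨B, hB⟩ := hφ.exists_fin h A
    exact absurd (hB.symm.trans hX) (by simp)
  | line P a => exact ⟨P, a, hX⟩
  | inf => exact absurd (h.symm.trans hX) (by simp)

/-- Lines with the same projection are mutually coherent, so the projection of the image of `line P
a` does not depend on `a`; this gives `π`. Subtracting the image of `0` normalizes the map, and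
singular means coherent to `0`. -/
theorem IsAutomorphism.exists_nullMap {φ : HBar → HBar} (hφ : IsAutomorphism φ)
    (h : φ inf = inf) :
    ∃ (B : H2) (φ₀ : H2 → H2) (π : Proj → Proj) (f : Proj → ℝ → ℝ),
      NullMap φ₀ π f ∧ ∀ A, φ (fin A) = fin (φ₀ A + B) := by
  choose φ₁ hφ₁ using hφ.exists_fin h
  choose π' f' hl using hφ.exists_line h
  have hπ : ∀ P a, φ (line P a) = line (π' P 0) (f' P a) := by
    intro P a
    have hc : Coherent (φ (line P a)) (φ (line P 0)) := (hφ.2 _ _).1 rfl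
    rw [hl, hl] at hc
    rw [hl, show π' P a = π' P 0 from hc]
  have hpol : ∀ P A, pol (π' P 0).toH2 (φ₁ A) = f' P (pol P.toH2 A) := by
    intro P A
    rw [← coherent_line_fin, ← hπ, ← hφ₁, ← hφ.2, coherent_line_fin]
  have hpol0 : ∀ P, pol (π' P 0).toH2 (φ₁ 0) = f' P 0 := by
    intro P
    rw [hpol, pol_zero]
  refine ⟨φ₁ 0, fun A => φ₁ A - φ₁ 0, fun P => π' P 0, fun P a => f' P a - f' P 0,
    ⟨fun Q => ?_, fun P => ⟨fun a b hab => ?_, fun b => ?_⟩, fun P => sub_self _, fun P A => ?_,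
      fun A hA => ?_⟩, fun A => ?_⟩
  · obtain ⟨P, a, hP⟩ := hφ.exists_line_eq h Q 0
    rw [hπ] at hP
    exact ⟨P, (line.inj hP).1⟩
  · have hab' : f' P a = f' P b := sub_left_injective hab
    have := hφ.1.1 ((hπ P a).trans ((congrArg _ hab').trans (hπ P b).symm))
    exact (line.inj this).2
  · obtain ⟨P', a, hP⟩ := hφ.exists_line_eq h (π' P 0) (b + f' P 0)
    have hc : Coherent (line P' a) (line P 0) := (hφ.2 _ _).2 (by rw [hP, hπ]; rfl)
    obtain rfl : P' = P := hc
    rw [hπ] at hP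
    refine ⟨a, ?_⟩
    have := (line.inj hP).2
    simp only [this, add_sub_cancel_right]
  · rw [pol_sub, hpol, hpol0]
  · rw [← coherent_fin_fin, ← hφ₁, ← hφ₁, ← hφ.2, coherent_fin_fin, sub_zero]
    exact hA
  · rw [sub_add_cancel, hφ₁]

theorem IsAutomorphism.isAffineAutomorphism {φ : HBar → HBar} (hφ : IsAutomorphism φ)
    (h : φ inf = inf) : IsAffineAutomorphism φ := by
  obtain ⟨B, φ₀, π, f, hn, hfin⟩ := hφ.exists_nullMap h
  obtain ⟨c, S, hS⟩ := hn.exists_conj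
  have hadd : ∀ A, φ (fin A) = add (fin (φ₀ A)) B := hfin
  have hp := ((preservesLines_add B).comp (preservesLines_signMul c)).comp (preservesLines_conj S)
  refine ⟨hφ, c, S, B, hS.imp (fun hS => ?_) fun hS => ?_⟩
  · exact eq_of_eq_on_fin hφ h hp fun A => by rw [hadd, hS]; rfl
  · exact eq_of_eq_on_fin hφ h (hp.comp preservesLines_transpose) fun A => by rw [hadd, hS]; rfl

theorem IsAffineAutomorphism.map_inf {φ : HBar → HBar} (h : IsAffineAutomorphism φ) :
    φ inf = inf := by
  obtain ⟨-, c, S, B, h | h⟩ := h <;> rw [h] <;>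
    rcases Int.units_eq_one_or c with rfl | rfl <;> rfl

/-- If `inf` goes to a matrix `A`, translating by `-A` and inverting returns it to `inf`, and the
composite is affine. If it goes to a line, a translation followed by an inversion first moves the
image into `H2`. -/
theorem IsAutomorphism.isStandardComposition {φ : HBar → HBar} (hφ : IsAutomorphism φ) :
    IsStandardComposition φ := by
  have key : ∀ ψ, IsAutomorphism ψ → ∀ A, ψ inf = fin A → IsStandardComposition ψ := by
    intro ψ hψ A hA
    have h1 : IsAutomorphism (inv ∘ (fun X => add X (-A)) ∘ ψ) :=
      isAutomorphism_inv.comp ((isAutomorphism_add _).comp hψ)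
    have h2 := h1.isAffineAutomorphism (by simp [hA, add, inv])
    have h3 : ψ = (fun X => add X A) ∘ inv ∘ (inv ∘ (fun X => add X (-A)) ∘ ψ) := by
      funext X
      simp only [Function.comp, inv_inv, add_add, neg_add_cancel, add_zero]
    rw [h3]
    exact .comp (.affine (isAffineAutomorphism_add A)) (.comp .inversion (.affine h2))
  cases hX : φ inf with
  | inf => exact .affine (hφ.isAffineAutomorphism hX)
  | fin A => exact key φ hφ A hX
  | line P a =>
    -- The inverse of a line is a matrix only when its real coordinate is nonzero; this translation
    -- makes the coordinate `1`.
    have hB : a + pol P.toH2 ((1 - a) • (1 : H2)) ≠ 0 := by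
      rw [pol_smul, P.pol_one]
      norm_num
    set B : H2 := (1 - a) • (1 : H2)
    have h1 : IsAutomorphism (inv ∘ (fun X => add X B) ∘ φ) :=
      isAutomorphism_inv.comp ((isAutomorphism_add _).comp hφ)
    have h2 := key _ h1 _ (by
      simp only [Function.comp, hX, line_add, inv, if_neg hB]
      rfl)
    have h3 : φ = (fun X => add X (-B)) ∘ inv ∘ (inv ∘ (fun X => add X B) ∘ φ) := by
      funext X
      simp only [Function.comp, inv_inv, add_add, add_neg_cancel, add_zero]
    rw [h3]
    exact .comp (.affine (isAffineAutomorphism_add _)) (.comp .inversion h2)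

end HBar
end HTwo

theorem mainTheorem8 :
    (∀ φ : HTwo.HBar → HTwo.HBar,
      HTwo.HBar.IsAutomorphism φ → HTwo.HBar.IsStandardAutomorphism φ) ∧
    (∀ φ : HTwo.HBar → HTwo.HBar,
      HTwo.HBar.IsAutomorphism φ →
        (HTwo.HBar.IsAffineAutomorphism φ ↔ φ HTwo.HBar.inf = HTwo.HBar.inf)) :=
  ⟨fun _ hφ => ⟨hφ, hφ.isStandardComposition⟩,
    fun _ hφ => ⟨fun h => h.map_inf, fun h => hφ.isAffineAutomorphism h⟩⟩
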